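/- For $\lambda>|q|$ let $v_\lambda(x)=\lambda\,\mathrm{sech}\big(\lambda|x|+\tanh^{-1}(q/\lambda)\big)$, $x\in\mathbb R$. On $L^2(\mathbb R;\mathbb C)$ let $$L_{q+}=\tfrac12\big(1-\partial_x^2-6v_1^2-2q\delta_0\big),\qquad L_{q-}=\tfrac12\big(1-\partial_x^2-2v_1^2-2q\delta_0\big),$$ with common domain the set of $u\in H^2(\mathbb R\setminus\{0\})$ that are continuous at $0$ and satisfy $u'(0+)-u'(0-)=-2q\,u(0)$ (the operators act by $\frac12(u-u''-6v_1^2u)$, resp. $\frac12(u-u''-2v_1^2u)$, away from $0$). Let $$F_q=\begin{bmatrix}0&L_{q-}\\-L_{q+}&0\end{bmatrix}\quad\text{on } L^2(\mathbb R;\mathbb C)^2,$$ which is the complexification of the linearized operator under $w\simeq[\mathrm{Re}\,w,\mathrm{Im}\,w]^t$; in particular write $iv_1=[0,v_1]^t$ and $\partial_\lambda v_\lambda|_{\lambda=1}=[\partial_\lambda v_\lambda|_{\lambda=1},0]^t$. Let $\sigma_3=\mathrm{diag}(1,-1)$. There are constants $q_0,\delta,C>0$ such that for all real $q$ with $0<|q|<q_0$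 the following holds. 1. The generalized kernel $\bigcup_n\ker F_q^n$ is two-dimensional, spanned by $iv_1$ and $\partial_\lambda v_\lambda|_{\lambda=1}$, and $$F_q(iv_1)=0,\qquad F_q\big(\partial_\lambda v_\lambda|_{\lambda=1}\big)=iv_1 .$$ 2. The eigenvalues of $F_q$ in $\{|z|<\delta\}$ are exactly $0$ and two further, nonzero, distinct eigenvalues $i\lambda_q^+$ and $i\lambda_q^-$, where $$\big|\lambda_q^\pm\mp q^{1/2}\big|\le C|q|^{3/2}\ \text{ if } q>0,\qquad \big|\lambda_q^\pm\mp i|q|^{1/2}\big|\le C|q|^{3/2}\ \text{ if } q<0 .$$ (So $\lambda_q^\pm$ are eigenvalues of $-iF_q$.) Both are algebraically simple: their generalized eigenspaces are spanned by eigenfunctions $w_q^\pm\ne0$. 3. The eigenfunctions $w_q^\pm$ are odd and can be chosen so that $\sigma_3w_q^\pm=w_q^\mp$. -/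

import Mathlib

open MeasureTheory Filter Topology

noncomputable section

namespace DeltaNLS

/-- The Hilbert space `L²(ℝ; ℂ)`. -/
abbrev L2 : Type := Lp ℂ 2 (volume : Measure ℝ)

/-- The nonlinear ground state `v_l(x) = l sech(l |x| + artanh(q / l))`. -/
def groundState (q l x : ℝ) : ℝ := l / Real.cosh (l * |x| + Real.artanh (q / l))

/-- `f ∈ H²(ℝ ∖ {0})` with first derivative `f₁` and second derivative `f₂` on `ℝ ∖ {0}`:
all three are in `L²`, `f` is `C¹` off the origin with derivative `f₁`, and `f₁` is locally
absolutely continuous off the origin with derivative `f₂`. -/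
structure IsH2Off (f f₁ f₂ : ℝ → ℂ) : Prop where
  memLp : MemLp f 2 volume
  memLp_one : MemLp f₁ 2 volume
  memLp_two : MemLp f₂ 2 volume
  hasDerivAt : ∀ x : ℝ, x ≠ 0 → HasDerivAt f (f₁ x) x
  sub_eq_integral : ∀ a b : ℝ, (0 : ℝ) ∉ Set.uIcc a b → f₁ b - f₁ a = ∫ t in a..b, f₂ t

/-- The domain of `-∂ₓ² - 2 q δ₀`: functions in `H²(ℝ ∖ {0})`, continuous at `0`, with the jump
condition `f'(0+) - f'(0-) = -2 q f(0)`. -/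
structure InDomain (q : ℝ) (f f₁ f₂ : ℝ → ℂ) : Prop extends IsH2Off f f₁ f₂ where
  continuousAt_zero : ContinuousAt f 0
  jump : ∃ a b : ℂ, Tendsto f₁ (𝓝[>] 0) (𝓝 a) ∧ Tendsto f₁ (𝓝[<] 0) (𝓝 b) ∧
    a - b = -2 * (q : ℂ) * f 0

theorem InDomain.add {q : ℝ} {f f₁ f₂ g g₁ g₂ : ℝ → ℂ} (hf : InDomain q f f₁ f₂)
    (hg : InDomain q g g₁ g₂) :
    InDomain q (fun x => f x + g x) (fun x => f₁ x + g₁ x) (fun x => f₂ x + g₂ x) where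
  memLp := hf.memLp.add hg.memLp
  memLp_one := hf.memLp_one.add hg.memLp_one
  memLp_two := hf.memLp_two.add hg.memLp_two
  hasDerivAt x hx := (hf.hasDerivAt x hx).add (hg.hasDerivAt x hx)
  sub_eq_integral a b h := by
    have i1 : IntervalIntegrable f₂ volume a b :=
      ((hf.memLp_two.locallyIntegrable (by norm_num)).integrableOn_isCompact
        isCompact_uIcc).intervalIntegrable
    have i2 : IntervalIntegrable g₂ volume a b :=
      ((hg.memLp_two.locallyIntegrable (by norm_num)).integrableOn_isCompact
        isCompact_uIcc).intervalIntegrable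
    rw [intervalIntegral.integral_add i1 i2, ← hf.sub_eq_integral a b h,
      ← hg.sub_eq_integral a b h]
    ring
  continuousAt_zero := hf.continuousAt_zero.add hg.continuousAt_zero
  jump := by
    obtain ⟨a, b, ha, hb, hab⟩ := hf.jump
    obtain ⟨c, d, hc, hd, hcd⟩ := hg.jump
    exact ⟨a + c, b + d, ha.add hc, hb.add hd, by linear_combination hab + hcd⟩

theorem InDomain.smul {q : ℝ} {f f₁ f₂ : ℝ → ℂ} (c : ℂ) (hf : InDomain q f f₁ f₂) :
    InDomain q (fun x => c * f x) (fun x => c * f₁ x) (fun x => c * f₂ x) where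
  memLp := hf.memLp.const_mul c
  memLp_one := hf.memLp_one.const_mul c
  memLp_two := hf.memLp_two.const_mul c
  hasDerivAt x hx := (hf.hasDerivAt x hx).const_mul c
  sub_eq_integral a b h := by
    rw [intervalIntegral.integral_const_mul, ← hf.sub_eq_integral a b h]
    ring
  continuousAt_zero := hf.continuousAt_zero.const_mul c
  jump := by
    obtain ⟨a, b, ha, hb, hab⟩ := hf.jump
    exact ⟨c * a, c * b, ha.const_mul c, hb.const_mul c, by linear_combination c * hab⟩

theorem InDomain.zero (q : ℝ) :
    InDomain q (fun _ => 0) (fun _ => 0) (fun _ => 0) where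
  memLp := MemLp.zero'
  memLp_one := MemLp.zero'
  memLp_two := MemLp.zero'
  hasDerivAt x _ := hasDerivAt_const x 0
  sub_eq_integral a b _ := by simp
  continuousAt_zero := continuousAt_const
  jump := ⟨0, 0, tendsto_const_nhds, tendsto_const_nhds, by simp⟩

/-- The graph, in `L² × L²`, of the operator `½ (1 - ∂ₓ² - W - 2 q δ₀)`, acting as
`½ (f - f'' - W f)` away from the origin on functions that satisfy the jump condition. -/
def schrodingerGraph (q : ℝ) (W : ℝ → ℝ) : Submodule ℂ (L2 × L2) where
  carrier := {p | ∃ f f₁ f₂ : ℝ → ℂ, InDomain q f f₁ f₂ ∧ p.1 =ᵐ[volume] f ∧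
    p.2 =ᵐ[volume] fun x => (1 / 2 : ℂ) * (f x - f₂ x - (W x : ℂ) * f x)}
  zero_mem' := by
    refine ⟨_, _, _, InDomain.zero q, Lp.coeFn_zero _ _ _, ?_⟩
    filter_upwards [Lp.coeFn_zero ℂ 2 (volume : Measure ℝ)] with x hx
    simp [hx]
  add_mem' := by
    rintro ⟨u, k⟩ ⟨u', k'⟩ ⟨f, f₁, f₂, hf, hu, hk⟩ ⟨g, g₁, g₂, hg, hu', hk'⟩
    refine ⟨_, _, _, hf.add hg, ?_, ?_⟩
    · filter_upwards [Lp.coeFn_add u u', hu, hu'] with x h1 h2 h3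
      simp only [Prod.mk_add_mk] at *
      rw [h1, Pi.add_apply, h2, h3]
    · filter_upwards [Lp.coeFn_add k k', hk, hk'] with x h1 h2 h3
      simp only [Prod.mk_add_mk] at *
      rw [h1, Pi.add_apply, h2, h3]
      ring
  smul_mem' := by
    rintro c ⟨u, k⟩ ⟨f, f₁, f₂, hf, hu, hk⟩
    refine ⟨_, _, _, hf.smul c, ?_, ?_⟩
    · filter_upwards [Lp.coeFn_smul c u, hu] with x h1 h2
      simp only [Prod.smul_mk] at *
      rw [h1, Pi.smul_apply, h2, smul_eq_mul]
    · filter_upwards [Lp.coeFn_smul c k, hk] with x h1 h2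
      simp only [Prod.smul_mk] at *
      rw [h1, Pi.smul_apply, h2, smul_eq_mul]
      ring

/-- `schrodingerGraph q W` is the graph of an operator. -/
theorem schrodingerGraph_functional (q : ℝ) (W : ℝ → ℝ) (p : L2 × L2)
    (hp : p ∈ schrodingerGraph q W) (h0 : p.1 = 0) : p.2 = 0 := by
  obtain ⟨f, f₁, f₂, hf, hu, hk⟩ := hp
  rw [h0] at hu
  have hfc : Continuous f := continuous_iff_continuousAt.2 fun x => by
    by_cases hx : x = 0
    · rw [hx]; exact hf.continuousAt_zero
    · exact (hf.hasDerivAt x hx).continuousAt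
  have hf0 : f = fun _ => 0 := by
    refine (Continuous.ae_eq_iff_eq volume hfc continuous_const).1 ?_
    filter_upwards [hu, Lp.coeFn_zero ℂ 2 (volume : Measure ℝ)] with x h1 h2
    rw [← h1, h2, Pi.zero_apply]
  have hf1 : ∀ x : ℝ, x ≠ 0 → f₁ x = 0 := fun x hx => by
    have h := hf.hasDerivAt x hx
    rw [hf0] at h
    exact h.unique (hasDerivAt_const x 0)
  have hf2 : ∀ᵐ x : ℝ, f₂ x = 0 := by
    have hne : ∀ᵐ x : ℝ, x ≠ 0 := by simp [ae_iff, measure_singleton]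
    filter_upwards [hne,
      LocallyIntegrable.ae_hasDerivAt_integral
        (hf.memLp_two.locallyIntegrable (by norm_num))] with x hx h
    have h1 : (fun y => ∫ t in x..y, f₂ t) =ᶠ[𝓝 x] fun _ => 0 := by
      obtain ⟨ε, hε, hb⟩ := Metric.isOpen_iff.1 isOpen_ne x hx
      filter_upwards [Metric.ball_mem_nhds x hε] with y hy
      have hsub : Set.uIcc x y ⊆ Metric.ball x ε := by
        rw [← segment_eq_uIcc]
        exact (convex_ball x ε).segment_subset (Metric.mem_ball_self hε) hy
      rw [← hf.sub_eq_integral x y fun h0 => hb (hsub h0) rfl, hf1 x hx, hf1 y (hb hy), sub_zero]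
    exact (h x).unique ((hasDerivAt_const x (0 : ℂ)).congr_of_eventuallyEq h1)
  refine Lp.ext ?_
  filter_upwards [hk, hf2, Lp.coeFn_zero ℂ 2 (volume : Measure ℝ)] with x h1 h2 h3
  rw [h1, h3, h2, hf0]
  simp

/-- The unbounded operator `½ (1 - ∂ₓ² - W - 2 q δ₀)` on `L²(ℝ; ℂ)`. -/
def schrodinger (q : ℝ) (W : ℝ → ℝ) : L2 →ₗ.[ℂ] L2 := (schrodingerGraph q W).toLinearPMap

theorem mem_graph_schrodinger (q : ℝ) (W : ℝ → ℝ) (p : L2 × L2) :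
    p ∈ (schrodinger q W).graph ↔ ∃ f f₁ f₂ : ℝ → ℂ, InDomain q f f₁ f₂ ∧ p.1 =ᵐ[volume] f ∧
      p.2 =ᵐ[volume] fun x => (1 / 2 : ℂ) * (f x - f₂ x - (W x : ℂ) * f x) := by
  rw [schrodinger, Submodule.toLinearPMap_graph_eq _ (schrodingerGraph_functional q W)]
  exact Iff.rfl

/-- `L_{q+} = ½ (1 - ∂ₓ² - 6 v₁² - 2 q δ₀)`. -/
def Lplus (q : ℝ) : L2 →ₗ.[ℂ] L2 := schrodinger q fun x => 6 * groundState q 1 x ^ 2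

/-- `L_{q-} = ½ (1 - ∂ₓ² - 2 v₁² - 2 q δ₀)`. -/
def Lminus (q : ℝ) : L2 →ₗ.[ℂ] L2 := schrodinger q fun x => 2 * groundState q 1 x ^ 2

/-- The linearized operator `F_q (a, b) = (L_{q-} b, -L_{q+} a)` on (complexified) pairs
(real part, imaginary part). -/
def F (q : ℝ) : (L2 × L2) →ₗ.[ℂ] (L2 × L2) where
  domain := (Lplus q).domain.prod (Lminus q).domain
  toFun :=
    { toFun := fun u => (Lminus q ⟨u.1.2, u.2.2⟩, -(Lplus q ⟨u.1.1, u.2.1⟩))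
      map_add' := fun u w => Prod.ext
        ((Lminus q).map_add ⟨u.1.2, u.2.2⟩ ⟨w.1.2, w.2.2⟩)
        ((congrArg Neg.neg ((Lplus q).map_add ⟨u.1.1, u.2.1⟩ ⟨w.1.1, w.2.1⟩)).trans
          (neg_add _ _))
      map_smul' := fun c u => Prod.ext
        ((Lminus q).map_smul c ⟨u.1.2, u.2.2⟩)
        ((congrArg Neg.neg ((Lplus q).map_smul c ⟨u.1.1, u.2.1⟩)).trans
          (smul_neg c _).symm) }

section Spectral

variable {E : Type*} [AddCommGroup E] [Module ℂ E]

/-- `z` is an eigenvalue of the unbounded operator `T`. -/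
def IsEigenvalue (T : E →ₗ.[ℂ] E) (z : ℂ) : Prop :=
  ∃ u : T.domain, (u : E) ≠ 0 ∧ T u = z • (u : E)

/-- `ker (T - z)ⁿ`: it is `0` for `n = 0`, and `u ∈ ker (T - z)ⁿ⁺¹` if and only if `u` is in the
domain of `T` and `T u - z u ∈ ker (T - z)ⁿ`. -/
def kerPow (T : E →ₗ.[ℂ] E) (z : ℂ) : ℕ → Submodule ℂ E
  | 0 => ⊥
  | n + 1 => ((kerPow T z n).comap (T.toFun - z • T.domain.subtype)).map T.domain.subtype

theorem mem_kerPow_succ (T : E →ₗ.[ℂ] E) (z : ℂ) (n : ℕ) (u : E) :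
    u ∈ kerPow T z (n + 1) ↔ ∃ h : u ∈ T.domain, T ⟨u, h⟩ - z • u ∈ kerPow T z n := by
  constructor
  · rintro ⟨⟨w, hw⟩, h, rfl⟩
    exact ⟨hw, h⟩
  · rintro ⟨h, hu⟩
    exact ⟨⟨u, h⟩, hu, rfl⟩

/-- The generalized eigenspace `⋃ₙ ker (T - z)ⁿ`. -/
def genEigenspace (T : E →ₗ.[ℂ] E) (z : ℂ) : Submodule ℂ E := ⨆ n, kerPow T z n

end Spectral

/-- The Pauli matrix `σ₃ = diag(1, -1)`. -/
def sigma3 (u : L2 × L2) : L2 × L2 := (u.1, -u.2)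

/-- Both components are odd functions. -/
def IsOdd (u : L2 × L2) : Prop :=
  ∀ᵐ x : ℝ, u.1 (-x) = -u.1 x ∧ u.2 (-x) = -u.2 x

end DeltaNLS

end

noncomputable section

namespace DeltaNLS

/-! Since $v_1(x)=\mathrm{sech}(|x|+\tanh^{-1}q)$, on each half-line the linearization has the
potential of the free soliton translated by $y=\tanh^{-1}q$, and that system is explicitly solvable.
Put $z=il$ and write the second component as $ib$: the equation $F_qw=zw$ becomes $L_{q-}b=la$,
$L_{q+}a=lb$. For $k^2=1-2l$ and $m^2=1+2l$ the pairs $(A_k,B_k)$ and $(A_m,-B_m)$, polynomials in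
$\tanh$ times exponentials (`jostA`, `jostB`), solve it and decay; for small $l$ they span all
decaying solutions (`DecaySol.exists_eq_jost`, by Wronskians). So an eigenfunction is given by four
constants, two for its even part and two for its odd part, subject to matching at the origin
(`FRep.exists_coeff`).

The even part must satisfy $A'+qA=0$ at $0+$. As $\tanh y=q$, the left side is the value there of
$(\partial+\tanh)A$, which is explicit, and the even part vanishes for $l\ne0$
(`even_coeff_eq_zero`). The odd part must vanish at the origin, which is possible exactly when a
$2\times2$ determinant does. With $K=k+m$ this reads $K^2+2qK+4q^2-4=0$; the root near $2$ is
$K=\sqrt{4-3q^2}-q$, and $16l^2=K^2(4-K^2)$ turns it into $l^2=\frac12q(1-q^2)K=q+O(q^2)$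
(`jost_det_eq_zero_iff`, `eigSq`). Hence there are two opposite roots, real or imaginary with the
sign of $q$, and odd eigenfunctions. Since $\sigma_3$ anticommutes with $F_q$, it exchanges the two.

Simplicity: if $(F_q-z)u=\gamma w$ with $w=(a,b)$ an eigenfunction, the symmetry of the Schrödinger
operators gives $\gamma\int ab=0$. The factorization $2L_{q-}=(-\partial+\tanh)(\partial+\tanh)$ on
the half-line shows that $\int ab$ is a nonzero multiple of $\int G^2$ with $G$ real and not
identically zero (`integral_eig_ne_zero`). At $z=0$ the same pairing ends the chain
$\partial_\lambda v\mapsto iv_1\mapsto0$, because $\int v_1\,\partial_\lambda v=1$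
(`genEigenspace_zero`). -/

/-! ### Hyperbolic tangent and secant. -/

/-- The hyperbolic tangent of a real number, as a complex number. -/
def th (y : ℝ) : ℂ := (Real.tanh y : ℂ)

/-- The hyperbolic secant of a real number, as a complex number. -/
def sech (y : ℝ) : ℂ := ((Real.cosh y)⁻¹ : ℝ)

theorem hasDerivAt_real_tanh (y : ℝ) : HasDerivAt Real.tanh (1 - Real.tanh y ^ 2) y := by
  have h := (Real.hasDerivAt_sinh y).div (Real.hasDerivAt_cosh y) (Real.cosh_pos y).ne'
  have e : Real.tanh = Real.sinh / Real.cosh := by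
    ext x; simp [Real.tanh_eq_sinh_div_cosh]
  rw [e]
  refine h.congr_deriv ?_
  have := (Real.cosh_pos y).ne'
  simp only [Pi.div_apply]
  field_simp

theorem hasDerivAt_th (y : ℝ) : HasDerivAt th (1 - th y ^ 2) y := by
  refine (hasDerivAt_real_tanh y).ofReal_comp.congr_deriv ?_
  simp [th]

theorem hasDerivAt_real_sech (y : ℝ) :
    HasDerivAt (fun y => (Real.cosh y)⁻¹) (-(Real.tanh y * (Real.cosh y)⁻¹)) y := by
  have h := (Real.hasDerivAt_cosh y).inv (Real.cosh_pos y).ne'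
  refine h.congr_deriv ?_
  have := (Real.cosh_pos y).ne'
  rw [Real.tanh_eq_sinh_div_cosh]
  field_simp

theorem hasDerivAt_sech (y : ℝ) : HasDerivAt sech (-(th y * sech y)) y := by
  refine (hasDerivAt_real_sech y).ofReal_comp.congr_deriv ?_
  simp [th, sech]

theorem real_sech_sq (y : ℝ) : ((Real.cosh y)⁻¹) ^ 2 = 1 - Real.tanh y ^ 2 := by
  have := (Real.cosh_pos y).ne'
  rw [Real.tanh_eq_sinh_div_cosh]
  field_simp
  linarith [Real.cosh_sq y]

theorem sech_sq (y : ℝ) : sech y ^ 2 = 1 - th y ^ 2 := by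
  have := congrArg (fun x : ℝ => (x : ℂ)) (real_sech_sq y)
  simpa [th, sech] using this

theorem continuous_th : Continuous th :=
  continuous_iff_continuousAt.2 fun y => (hasDerivAt_th y).continuousAt

theorem continuous_sech : Continuous sech :=
  continuous_iff_continuousAt.2 fun y => (hasDerivAt_sech y).continuousAt

theorem norm_th_le (y : ℝ) : ‖th y‖ ≤ 1 := by
  rw [th, Complex.norm_real]
  exact (Real.abs_tanh_lt_one y).le

theorem sech_eq_exp (y : ℝ) : sech y = (1 + th y) * Complex.exp (-y) := by
  have h : (Real.cosh y)⁻¹ = (1 + Real.tanh y) * Real.exp (-y) := by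
    have := (Real.cosh_pos y).ne'
    rw [Real.tanh_eq_sinh_div_cosh]
    field_simp
    rw [Real.cosh_add_sinh, ← Real.exp_add]
    simp
  have := congrArg (fun x : ℝ => (x : ℂ)) h
  simpa [th, sech] using this

/-! ### Exponential decay on the half-line. -/

/-- A continuous function on the line that is `O(exp (-x / 2))` at `+∞`. -/
structure ExpDecay (A : ℝ → ℂ) : Prop where
  continuous : Continuous A
  isBigO : A =O[atTop] fun x => Real.exp (-(1 / 2) * x)

namespace ExpDecay

variable {A B : ℝ → ℂ}

theorem add (hA : ExpDecay A) (hB : ExpDecay B) : ExpDecay fun x => A x + B x :=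
  ⟨hA.continuous.add hB.continuous, hA.isBigO.add hB.isBigO⟩

theorem const_mul (c : ℂ) (hA : ExpDecay A) : ExpDecay fun x => c * A x :=
  ⟨hA.continuous.const_mul c, hA.isBigO.const_mul_left c⟩

theorem bdd_mul (hA : ExpDecay A) {C : ℝ} (hB : Continuous B) (hC : ∀ x, ‖B x‖ ≤ C) :
    ExpDecay fun x => B x * A x := by
  refine ⟨hB.mul hA.continuous, ?_⟩
  have h : B =O[atTop] fun _ => (1 : ℝ) :=
    Asymptotics.IsBigO.of_bound C (Eventually.of_forall fun x => by simpa using hC x)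
  simpa using h.mul hA.isBigO

theorem comp_add (hA : ExpDecay A) (c : ℝ) : ExpDecay fun x => A (x + c) := by
  refine ⟨hA.continuous.comp (continuous_add_const c), ?_⟩
  have h := hA.isBigO.comp_tendsto (tendsto_atTop_add_const_right atTop c tendsto_id)
  refine h.trans (Asymptotics.IsBigO.of_bound (Real.exp (-(1 / 2) * c))
    (Eventually.of_forall fun x => ?_))
  simp only [Function.comp, id, Real.norm_eq_abs, Real.abs_exp, ← Real.exp_add]
  apply le_of_eq
  ring_nf

theorem memLp (hA : ExpDecay A) : MemLp A 2 (volume.restrict (Set.Ioi 0)) := by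
  rw [memLp_two_iff_integrable_sq_norm hA.continuous.aestronglyMeasurable]
  refine integrable_of_isBigO_exp_neg (b := 1) one_pos
    (hA.continuous.norm.pow 2).continuousOn ?_
  refine (hA.isBigO.norm_left.pow 2).trans (Asymptotics.isBigO_of_le _ fun x => ?_)
  rw [← Real.exp_nat_mul]
  apply le_of_eq
  congr 2
  push_cast; ring

theorem tendsto (hA : ExpDecay A) : Tendsto A atTop (𝓝 0) := by
  refine hA.isBigO.trans_tendsto ?_
  refine Real.tendsto_exp_atBot.comp ?_
  exact tendsto_id.const_mul_atTop_of_neg (by norm_num)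

end ExpDecay

theorem expDecay_exp {k : ℂ} (hk : 1 / 2 ≤ k.re) :
    ExpDecay fun y : ℝ => Complex.exp (-(k * y)) := by
  refine ⟨by fun_prop, Asymptotics.IsBigO.of_bound 1 ?_⟩
  filter_upwards [eventually_ge_atTop 0] with y hy
  rw [Complex.norm_exp, one_mul, Real.norm_eq_abs, Real.abs_exp]
  apply Real.exp_le_exp.2
  simp
  nlinarith

theorem expDecay_sech : ExpDecay sech := by
  have h := (expDecay_exp (k := 1) (by norm_num)).bdd_mul (B := fun y => 1 + th y) (C := 2)
    (continuous_const.add continuous_th) fun y =>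
      (norm_add_le _ _).trans (by simpa using (by linarith [norm_th_le y] : 1 + ‖th y‖ ≤ 2))
  convert h using 1
  ext y
  rw [sech_eq_exp, one_mul]

/-- The decay rate $1/2$, below the rate $1$ of $\mathrm{sech}$, leaves room for the factor
$y=O(e^{y/2})$. It is needed for the frequency derivative of the ground state. -/
theorem expDecay_id_mul_sech : ExpDecay fun y => (y : ℂ) * sech y := by
  refine ⟨Complex.continuous_ofReal.mul continuous_sech, ?_⟩
  have h1 : (fun y : ℝ => (y : ℂ)) =O[atTop] fun y => Real.exp (1 / 2 * y) := by
    have := (isLittleO_pow_exp_pos_mul_atTop 1 (show (0 : ℝ) < 1 / 2 by norm_num)).isBigO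
    refine Asymptotics.IsBigO.trans (Asymptotics.isBigO_of_le _ fun x => ?_) this
    simp
  have h2 : sech =O[atTop] fun y => Real.exp (-y) := by
    refine Asymptotics.IsBigO.of_bound 2 (Eventually.of_forall fun y => ?_)
    rw [sech_eq_exp, norm_mul, Complex.norm_exp]
    simp only [Complex.neg_re, Complex.ofReal_re, Real.norm_eq_abs, Real.abs_exp]
    refine mul_le_mul_of_nonneg_right ((norm_add_le _ _).trans ?_) (Real.exp_nonneg _)
    simpa using (by linarith [norm_th_le y] : 1 + ‖th y‖ ≤ 2)
  refine (h1.mul h2).congr_right fun y => ?_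
  rw [← Real.exp_add]
  ring_nf

/-! ### Explicit decaying solutions of the linearized soliton system. -/

/-- First component of the decaying solution with exponent `k` of the linearized system. -/
def jostA (k : ℂ) (y : ℝ) : ℂ :=
  (k ^ 2 + 2 * k * th y + 2 * th y ^ 2 - 1) * Complex.exp (-(k * y))

/-- Derivative of `jostA`. -/
def jostA₁ (k : ℂ) (y : ℝ) : ℂ :=
  (2 * k * (1 - th y ^ 2) + 4 * th y * (1 - th y ^ 2) -
    k * (k ^ 2 + 2 * k * th y + 2 * th y ^ 2 - 1)) * Complex.exp (-(k * y))

/-- Second component of the decaying solution with exponent `k` of the linearized system. -/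
def jostB (k : ℂ) (y : ℝ) : ℂ :=
  (k ^ 2 + 1 + 2 * k * th y) * Complex.exp (-(k * y))

/-- Derivative of `jostB`. -/
def jostB₁ (k : ℂ) (y : ℝ) : ℂ :=
  (2 * k * (1 - th y ^ 2) - k * (k ^ 2 + 1 + 2 * k * th y)) * Complex.exp (-(k * y))

theorem hasDerivAt_exp_neg_mul (k : ℂ) (y : ℝ) :
    HasDerivAt (fun y : ℝ => Complex.exp (-(k * y))) (-k * Complex.exp (-(k * y))) y := by
  have h : HasDerivAt (fun y : ℝ => -(k * (y : ℂ))) (-(k * 1)) y :=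
    ((HasDerivAt.ofReal_comp (hasDerivAt_id y)).const_mul k).neg
  refine h.cexp.congr_deriv ?_
  ring

theorem hasDerivAt_jostA (k : ℂ) (y : ℝ) : HasDerivAt (jostA k) (jostA₁ k y) y := by
  have hT := hasDerivAt_th y
  have h := ((((hT.const_mul (2 * k)).const_add (k ^ 2)).add
    ((hT.pow 2).const_mul 2)).sub_const 1).mul (hasDerivAt_exp_neg_mul k y)
  refine h.congr_deriv ?_
  simp only [jostA₁, Pi.add_apply, Pi.pow_apply]
  push_cast
  ring

theorem hasDerivAt_jostB (k : ℂ) (y : ℝ) : HasDerivAt (jostB k) (jostB₁ k y) y := by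
  have hT := hasDerivAt_th y
  have h := ((hT.const_mul (2 * k)).const_add (k ^ 2 + 1)).mul (hasDerivAt_exp_neg_mul k y)
  refine h.congr_deriv ?_
  simp only [jostB₁]
  ring

/-- With $1-k^2=2l$, this and `hasDerivAt_jostB₁` are the equations $L_+A=lB$ and $L_-B=lA$ for the
soliton $\mathrm{sech}$. After $\tanh'=1-\tanh^2$ both are polynomial identities in $\tanh$. -/
theorem hasDerivAt_jostA₁ (k : ℂ) (y : ℝ) :
    HasDerivAt (jostA₁ k)
      ((1 - 6 * (1 - th y ^ 2)) * jostA k y - (1 - k ^ 2) * jostB k y) y := by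
  have hT := hasDerivAt_th y
  have hS := (hT.pow 2).const_sub 1
  have h := (((hS.const_mul (2 * k)).add ((hT.const_mul 4).mul hS)).sub
    (((((hT.const_mul (2 * k)).const_add (k ^ 2)).add
    ((hT.pow 2).const_mul 2)).sub_const 1).const_mul k)).mul (hasDerivAt_exp_neg_mul k y)
  refine h.congr_deriv ?_
  simp only [jostA, jostB, Pi.add_apply, Pi.pow_apply, Pi.sub_apply, Pi.mul_apply]
  push_cast
  ring

theorem hasDerivAt_jostB₁ (k : ℂ) (y : ℝ) :
    HasDerivAt (jostB₁ k)
      ((1 - 2 * (1 - th y ^ 2)) * jostB k y - (1 - k ^ 2) * jostA k y) y := by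
  have hT := hasDerivAt_th y
  have hS := (hT.pow 2).const_sub 1
  have h := ((hS.const_mul (2 * k)).sub
    (((hT.const_mul (2 * k)).const_add (k ^ 2 + 1)).const_mul k)).mul
    (hasDerivAt_exp_neg_mul k y)
  refine h.congr_deriv ?_
  simp only [jostA, jostB, Pi.pow_apply, Pi.sub_apply]
  push_cast
  ring

theorem norm_poly_th_le (a b c d : ℂ) (y : ℝ) :
    ‖a + b * th y + c * th y ^ 2 + d * th y ^ 3‖ ≤ ‖a‖ + ‖b‖ + ‖c‖ + ‖d‖ := by
  have h := norm_th_le y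
  have h0 := norm_nonneg (th y)
  refine (norm_add_le _ _).trans (add_le_add ((norm_add_le _ _).trans
    (add_le_add ((norm_add_le _ _).trans (add_le_add le_rfl ?_)) ?_)) ?_)
  · rw [norm_mul]; exact mul_le_of_le_one_right (norm_nonneg _) h
  · rw [norm_mul, norm_pow]; exact mul_le_of_le_one_right (norm_nonneg _) (pow_le_one₀ h0 h)
  · rw [norm_mul, norm_pow]; exact mul_le_of_le_one_right (norm_nonneg _) (pow_le_one₀ h0 h)

theorem ExpDecay.poly_th_mul {A : ℝ → ℂ} (hA : ExpDecay A) (a b c d : ℂ) :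
    ExpDecay fun y => (a + b * th y + c * th y ^ 2 + d * th y ^ 3) * A y := by
  have hT := continuous_th
  exact hA.bdd_mul (by fun_prop) (norm_poly_th_le a b c d)

variable {k : ℂ}

theorem expDecay_jostA (hk : 1 / 2 ≤ k.re) : ExpDecay (jostA k) := by
  convert (expDecay_exp hk).poly_th_mul (k ^ 2 - 1) (2 * k) 2 0 using 2 with y
  rw [jostA]; ring

theorem expDecay_jostB (hk : 1 / 2 ≤ k.re) : ExpDecay (jostB k) := by
  convert (expDecay_exp hk).poly_th_mul (k ^ 2 + 1) (2 * k) 0 0 using 2 with y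
  rw [jostB]; ring

theorem expDecay_jostA₁ (hk : 1 / 2 ≤ k.re) : ExpDecay (jostA₁ k) := by
  convert (expDecay_exp hk).poly_th_mul (2 * k - k ^ 3 + k) (4 - 2 * k ^ 2)
    (-4 * k) (-4) using 2 with y
  rw [jostA₁]; ring

theorem expDecay_jostB₁ (hk : 1 / 2 ≤ k.re) : ExpDecay (jostB₁ k) := by
  convert (expDecay_exp hk).poly_th_mul (k - k ^ 3) (-2 * k ^ 2) (-2 * k) 0 using 2 with y
  rw [jostB₁]; ring

/-! ### Even and odd extensions, and membership in the domain. -/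

/-- The even (`ε = 1`) or odd (`ε = -1`) extension to the line of a function on `[0, ∞)`. -/
def reflectExt (ε : ℂ) (A : ℝ → ℂ) (x : ℝ) : ℂ := if 0 ≤ x then A x else ε * A (-x)

theorem reflectExt_of_nonneg {ε : ℂ} {A : ℝ → ℂ} {x : ℝ} (hx : 0 ≤ x) :
    reflectExt ε A x = A x := if_pos hx

theorem reflectExt_of_neg {ε : ℂ} {A : ℝ → ℂ} {x : ℝ} (hx : x < 0) :
    reflectExt ε A x = ε * A (-x) := if_neg hx.not_ge

theorem hasDerivAt_reflectExt (ε : ℂ) {A A₁ : ℝ → ℂ} (hA : ∀ x, HasDerivAt A (A₁ x) x)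
    {x : ℝ} (hx : x ≠ 0) :
    HasDerivAt (reflectExt ε A) (reflectExt (-ε) A₁ x) x := by
  rcases hx.lt_or_gt with h | h
  · rw [reflectExt_of_neg h]
    have h1 : HasDerivAt (fun x => ε * A (-x)) (ε * (-A₁ (-x))) x := by
      have := (hA (-x)).scomp x (hasDerivAt_neg x)
      refine (this.const_mul ε).congr_deriv ?_
      simp
    refine (h1.congr_of_eventuallyEq ?_).congr_deriv (by ring)
    filter_upwards [Iio_mem_nhds h] with y hy using reflectExt_of_neg hy
  · rw [reflectExt_of_nonneg h.le]
    refine (hA x).congr_of_eventuallyEq ?_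
    filter_upwards [Ioi_mem_nhds h] with y hy using reflectExt_of_nonneg (le_of_lt hy)

theorem memLp_reflectExt (ε : ℂ) {A : ℝ → ℂ}
    (hA : MemLp A 2 (volume.restrict (Set.Ioi 0))) : MemLp (reflectExt ε A) 2 volume := by
  have h1 : MemLp ((Set.Ioi 0).indicator A) 2 volume :=
    (memLp_indicator_iff_restrict measurableSet_Ioi).2 hA
  have h2 : MemLp (((Set.Ioi 0).indicator A) ∘ Neg.neg) 2 volume :=
    h1.comp_measurePreserving (Measure.measurePreserving_neg volume)
  refine (h1.add (h2.const_mul ε)).ae_eq ?_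
  have hne : ∀ᵐ x : ℝ, x ≠ 0 := by simp [ae_iff, measure_singleton]
  filter_upwards [hne] with x hx
  rcases hx.lt_or_gt with h | h
  · simp [reflectExt_of_neg h, h, h.not_gt]
  · simp [reflectExt_of_nonneg h.le, h, h.not_gt]

/-- Differentiation flips parity, hence `-ε` for the first derivative. `h0` is continuity at the
origin and `h1` is the jump condition: for $\varepsilon=1$ only $A'(0)=-qA(0)$ remains, for
$\varepsilon=-1$ only $A(0)=0$. -/
theorem inDomain_reflectExt {q : ℝ} {ε : ℂ} {A A₁ A₂ : ℝ → ℂ}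
    (hA : ∀ x, HasDerivAt A (A₁ x) x) (hA₁ : ∀ x, HasDerivAt A₁ (A₂ x) x)
    (dA : ExpDecay A) (dA₁ : ExpDecay A₁) (dA₂ : ExpDecay A₂)
    (h0 : ε * A 0 = A 0) (h1 : A₁ 0 + ε * A₁ 0 = -2 * q * A 0) :
    InDomain q (reflectExt ε A) (reflectExt (-ε) A₁) (reflectExt ε A₂) where
  memLp := memLp_reflectExt _ dA.memLp
  memLp_one := memLp_reflectExt _ dA₁.memLp
  memLp_two := memLp_reflectExt _ dA₂.memLp
  hasDerivAt x hx := hasDerivAt_reflectExt ε hA hx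
  sub_eq_integral a b h := by
    rw [intervalIntegral.integral_eq_sub_of_hasDerivAt]
    · intro x hx
      have := hasDerivAt_reflectExt (-ε) hA₁ (fun h' => h (h' ▸ hx) : x ≠ 0)
      rwa [neg_neg] at this
    · exact (((memLp_reflectExt ε dA₂.memLp).locallyIntegrable
        (by norm_num)).integrableOn_isCompact isCompact_uIcc).intervalIntegrable
  continuousAt_zero := by
    refine Continuous.continuousAt (Continuous.if_le dA.continuous
      ((dA.continuous.comp continuous_neg).const_mul ε) continuous_const continuous_id ?_)
    rintro x rfl
    simp [h0]
  jump := by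
    refine ⟨A₁ 0, -ε * A₁ 0, ?_, ?_, ?_⟩
    · refine (dA₁.continuous.tendsto 0 |>.mono_left nhdsWithin_le_nhds).congr' ?_
      filter_upwards [self_mem_nhdsWithin] with x hx
      exact (reflectExt_of_nonneg (le_of_lt hx)).symm
    · have h2 : Tendsto (fun x => -ε * A₁ (-x)) (𝓝 0) (𝓝 (-ε * A₁ (-0))) :=
        ((dA₁.continuous.comp continuous_neg).const_mul (-ε)).tendsto 0
      rw [neg_zero] at h2
      refine (h2.mono_left nhdsWithin_le_nhds).congr' ?_
      filter_upwards [self_mem_nhdsWithin] with x hx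
      exact (reflectExt_of_neg hx).symm
    · rw [reflectExt_of_nonneg le_rfl, ← h1]; ring

/-! ### Decaying solutions on the half-line form the span of the two explicit ones. -/

/-- Both $f^2$ and its derivative $2ff'$ are integrable, so $f^2\to0$. -/
theorem tendsto_zero_of_memLp {f f₁ : ℝ → ℂ} (hf : ∀ x > 0, HasDerivAt f (f₁ x) x)
    (m : MemLp f 2 (volume.restrict (Set.Ioi 0)))
    (m₁ : MemLp f₁ 2 (volume.restrict (Set.Ioi 0))) : Tendsto f atTop (𝓝 0) := by
  have h : Tendsto (fun x => f x * f x) atTop (𝓝 0) := by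
    refine tendsto_zero_of_hasDerivAt_of_integrableOn_Ioi (a := 0)
      (f' := fun x => f₁ x * f x + f x * f₁ x) (fun x hx => (hf x hx).mul (hf x hx)) ?_ ?_
    · exact (m₁.integrable_mul m).add (m.integrable_mul m₁)
    · exact m.integrable_mul m
  rw [tendsto_zero_iff_norm_tendsto_zero] at h ⊢
  have h2 := h.sqrt
  simpa using h2

/-- A solution on `(0, ∞)`, decaying at infinity, of the system `L₋ b = l a`, `L₊ a = l b`, where
the potential is that of the soliton `sech` translated by `-x₀`. -/
structure DecaySol (l : ℂ) (x₀ : ℝ) (a a₁ b b₁ : ℝ → ℂ) : Prop where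
  ha : ∀ x > 0, HasDerivAt a (a₁ x) x
  ha₁ : ∀ x > 0, HasDerivAt a₁ ((1 - 6 * (1 - th (x + x₀) ^ 2)) * a x - 2 * l * b x) x
  hb : ∀ x > 0, HasDerivAt b (b₁ x) x
  hb₁ : ∀ x > 0, HasDerivAt b₁ ((1 - 2 * (1 - th (x + x₀) ^ 2)) * b x - 2 * l * a x) x
  ta : Tendsto a atTop (𝓝 0)
  ta₁ : Tendsto a₁ atTop (𝓝 0)
  tb : Tendsto b atTop (𝓝 0)
  tb₁ : Tendsto b₁ atTop (𝓝 0)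

namespace DecaySol

variable {l : ℂ} {x₀ : ℝ} {a a₁ b b₁ A A₁ B B₁ : ℝ → ℂ}

theorem add_smul (h : DecaySol l x₀ a a₁ b b₁) (H : DecaySol l x₀ A A₁ B B₁) (c : ℂ) :
    DecaySol l x₀ (fun x => a x + c * A x) (fun x => a₁ x + c * A₁ x)
      (fun x => b x + c * B x) (fun x => b₁ x + c * B₁ x) where
  ha x hx := (h.ha x hx).add ((H.ha x hx).const_mul c)
  hb x hx := (h.hb x hx).add ((H.hb x hx).const_mul c)
  ha₁ x hx := ((h.ha₁ x hx).add ((H.ha₁ x hx).const_mul c)).congr_deriv (by ring)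
  hb₁ x hx := ((h.hb₁ x hx).add ((H.hb₁ x hx).const_mul c)).congr_deriv (by ring)
  ta := by simpa using h.ta.add (H.ta.const_mul c)
  tb := by simpa using h.tb.add (H.tb.const_mul c)
  ta₁ := by simpa using h.ta₁.add (H.ta₁.const_mul c)
  tb₁ := by simpa using h.tb₁.add (H.tb₁.const_mul c)

/-- The coupling matrix of the system is symmetric, so the sum of the two componentwise Wronskians
is constant; decay makes the constant zero. -/
theorem wronskian_eq_zero (h : DecaySol l x₀ a a₁ b b₁) (H : DecaySol l x₀ A A₁ B B₁)
    {x : ℝ} (hx : 0 < x) :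
    a₁ x * A x - a x * A₁ x + (b₁ x * B x - b x * B₁ x) = 0 := by
  set W : ℝ → ℂ := fun x => a₁ x * A x - a x * A₁ x + (b₁ x * B x - b x * B₁ x) with hW
  have hd : ∀ y > 0, HasDerivAt W 0 y := fun y hy => by
    refine ((((h.ha₁ y hy).mul (H.ha y hy)).sub ((h.ha y hy).mul (H.ha₁ y hy))).add
      (((h.hb₁ y hy).mul (H.hb y hy)).sub ((h.hb y hy).mul (H.hb₁ y hy)))).congr_deriv ?_
    ring
  have ht : Tendsto W atTop (𝓝 0) := by
    have := ((h.ta₁.mul H.ta).sub (h.ta.mul H.ta₁)).add ((h.tb₁.mul H.tb).sub (h.tb.mul H.tb₁))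
    simpa using this
  have hc : ∀ y > 0, W y = W x := fun y hy =>
    isOpen_Ioi.is_const_of_deriv_eq_zero isPreconnected_Ioi
      (fun z hz => (hd z hz).differentiableAt.differentiableWithinAt)
      (fun z hz => (hd z hz).deriv) hy hx
  refine tendsto_nhds_unique (tendsto_const_nhds.congr' ?_) ht
  filter_upwards [eventually_gt_atTop 0] with y hy using (hc y hy).symm

theorem eq_zero (h : DecaySol l x₀ a a₁ b b₁) {t : ℝ} (ht : 0 < t)
    (h0 : a t = 0 ∧ a₁ t = 0 ∧ b t = 0 ∧ b₁ t = 0) :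
    ∀ x > 0, a x = 0 ∧ a₁ x = 0 ∧ b x = 0 ∧ b₁ x = 0 := by
  intro x hx
  let v : ℝ → ℂ × ℂ × ℂ × ℂ → ℂ × ℂ × ℂ × ℂ := fun x p =>
    (p.2.1, (1 - 6 * (1 - th (x + x₀) ^ 2)) * p.1 - 2 * l * p.2.2.1,
      p.2.2.2, (1 - 2 * (1 - th (x + x₀) ^ 2)) * p.2.2.1 - 2 * l * p.1)
  have hn : ∀ p : ℂ × ℂ × ℂ × ℂ, ‖p.1‖ ≤ ‖p‖ ∧ ‖p.2.1‖ ≤ ‖p‖ ∧ ‖p.2.2.1‖ ≤ ‖p‖ ∧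
      ‖p.2.2.2‖ ≤ ‖p‖ := fun p =>
    ⟨norm_fst_le p, (norm_fst_le p.2).trans (norm_snd_le p),
      (norm_fst_le p.2.2).trans ((norm_snd_le p.2).trans (norm_snd_le p)),
      (norm_snd_le p.2.2).trans ((norm_snd_le p.2).trans (norm_snd_le p))⟩
  have hcoef : ∀ c : ℝ, 0 ≤ c → c ≤ 6 → ∀ y, ‖1 - (c : ℂ) * (1 - th y ^ 2)‖ ≤ 7 := by
    intro c hc hc6 y
    have h1 : (1 : ℂ) - c * (1 - th y ^ 2) = ((1 - c * (1 - Real.tanh y ^ 2) : ℝ) : ℂ) := by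
      simp [th]
    rw [h1, Complex.norm_real, Real.norm_eq_abs, abs_le]
    have h2 := Real.tanh_sq_lt_one y
    have h3 := sq_nonneg (Real.tanh y)
    constructor <;> nlinarith
  -- The field is linear: $|1-c(1-\tanh^2)|\le7$ for $0\le c\le6$, and the coupling contributes
  -- $2|l|$.
  have hlip : ∀ x, LipschitzWith (Real.toNNReal (7 + 2 * ‖l‖)) (v x) := fun x => by
    refine LipschitzWith.of_dist_le_mul fun p p' => ?_
    rw [Real.coe_toNNReal _ (by positivity), dist_eq_norm, dist_eq_norm]
    have e : v x p - v x p' = v x (p - p') := by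
      ext <;> simp [v] <;> ring
    rw [e]
    obtain ⟨n1, n2, n3, n4⟩ := hn (p - p')
    set w := p - p'
    have hl := norm_nonneg l
    have hw := norm_nonneg w
    have hpos : 0 ≤ ‖l‖ * ‖w‖ := mul_nonneg hl hw
    have key : ∀ c : ℝ, 0 ≤ c → c ≤ 6 → ∀ s r : ℂ, ‖s‖ ≤ ‖w‖ → ‖r‖ ≤ ‖w‖ →
        ‖(1 - (c : ℂ) * (1 - th (x + x₀) ^ 2)) * s - 2 * l * r‖ ≤ (7 + 2 * ‖l‖) * ‖w‖ := by
      intro c hc hc6 s r hs hr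
      refine (norm_sub_le _ _).trans ?_
      rw [add_mul, norm_mul, norm_mul, norm_mul]
      refine add_le_add (mul_le_mul (hcoef c hc hc6 _) hs (norm_nonneg _) (by norm_num)) ?_
      rw [show ‖(2 : ℂ)‖ = 2 by norm_num]
      exact mul_le_mul_of_nonneg_left hr (by positivity)
    have k6 := key 6 (by norm_num) le_rfl w.1 w.2.2.1 n1 n3
    have k2 := key 2 (by norm_num) (by norm_num) w.2.2.1 w.1 n3 n1
    refine max_le ?_ (max_le ?_ (max_le ?_ ?_))
    · exact n2.trans (by nlinarith)
    · exact_mod_cast k6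
    · exact n4.trans (by nlinarith)
    · exact_mod_cast k2
  have key := ODE_solution_unique_of_mem_Ioo (v := v) (s := fun _ => Set.univ)
    (a := 0) (b := max x t + 1) (t₀ := t) (f := fun x => (a x, a₁ x, b x, b₁ x))
    (g := fun _ => 0)
    (fun y _ => (hlip y).lipschitzOnWith) ⟨ht, by linarith [le_max_right x t]⟩
    (fun y hy => ⟨(h.ha y hy.1).prodMk ((h.ha₁ y hy.1).prodMk
      ((h.hb y hy.1).prodMk (h.hb₁ y hy.1))), trivial⟩)
    (fun y _ => ⟨(hasDerivAt_const y _).congr_deriv (by simp [v]; rfl), trivial⟩)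
    (by simp [h0])
  have := key ⟨hx, (by linarith [le_max_left x t] : x < max x t + 1)⟩
  simpa using this

theorem jost {k : ℂ} (hk : 1 / 2 ≤ k.re) (hkl : k ^ 2 = 1 - 2 * l) (x₀ : ℝ) :
    DecaySol l x₀ (fun x => jostA k (x + x₀)) (fun x => jostA₁ k (x + x₀))
      (fun x => jostB k (x + x₀)) (fun x => jostB₁ k (x + x₀)) where
  ha x _ := (hasDerivAt_jostA k (x + x₀)).comp_add_const x x₀
  hb x _ := (hasDerivAt_jostB k (x + x₀)).comp_add_const x x₀
  ha₁ x _ := ((hasDerivAt_jostA₁ k (x + x₀)).comp_add_const x x₀).congr_deriv (by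
    rw [hkl]; ring)
  hb₁ x _ := ((hasDerivAt_jostB₁ k (x + x₀)).comp_add_const x x₀).congr_deriv (by
    rw [hkl]; ring)
  ta := ((expDecay_jostA hk).comp_add x₀).tendsto
  ta₁ := ((expDecay_jostA₁ hk).comp_add x₀).tendsto
  tb := ((expDecay_jostB hk).comp_add x₀).tendsto
  tb₁ := ((expDecay_jostB₁ hk).comp_add x₀).tendsto

/-- Source of the second decaying solution: the exponent $m$ with $m^2=1+2l$ solves the system for
$-l$, and a change of sign in the second component brings it back to $l$. -/
theorem neg_snd (h : DecaySol l x₀ a a₁ b b₁) :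
    DecaySol (-l) x₀ a a₁ (fun x => -b x) (fun x => -b₁ x) where
  ha := h.ha
  hb x hx := (h.hb x hx).neg
  ha₁ x hx := (h.ha₁ x hx).congr_deriv (by ring)
  hb₁ x hx := (h.hb₁ x hx).neg.congr_deriv (by ring)
  ta := h.ta
  ta₁ := h.ta₁
  tb := by simpa using h.tb.neg
  tb₁ := by simpa using h.tb₁.neg

end DecaySol

/-- The determinant of the values at a point of the two decaying solutions. -/
theorem jost_det {k m : ℂ} (h : k ^ 2 + m ^ 2 = 2) (y : ℝ) :
    jostA k y * jostB m y + jostA m y * jostB k y =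
      (k + m) / 2 * (k + m + 2 * th y) *
        ((k + m) ^ 2 + 2 * th y * (k + m) + 4 * th y ^ 2 - 4) *
        (Complex.exp (-(k * y)) * Complex.exp (-(m * y))) := by
  simp only [jostA, jostB]
  linear_combination (-(2 * k * m + 2 * th y * (k + m) + 2 * th y ^ 2 + (k ^ 2 + m ^ 2 - 2) / 2)) *
    (Complex.exp (-(k * y)) * Complex.exp (-(m * y))) * h

theorem half_le_re {k : ℂ} (hk : ‖k - 1‖ ≤ 1 / 8) : 1 / 2 ≤ k.re := by
  have h := (Complex.abs_re_le_norm (k - 1)).trans hk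
  rw [abs_le] at h
  simp at h
  linarith [h.1]

/-- At $\tanh y=1/2$ and $k+m$ near $2$ the three algebraic factors are near $1$, $3$, $3$. A point
away from the origin is required, since at $\tanh y=q$ the last factor is small and its zeros are
the eigenvalues sought. -/
theorem jost_det_ne_zero {k m : ℂ} (h : k ^ 2 + m ^ 2 = 2) (hk : ‖k - 1‖ ≤ 1 / 8)
    (hm : ‖m - 1‖ ≤ 1 / 8) {y : ℝ} (hy : th y = 1 / 2) :
    jostA k y * jostB m y + jostA m y * jostB k y ≠ 0 := by
  rw [jost_det h, hy]
  have hK : ‖k + m - 2‖ ≤ 1 / 4 := by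
    rw [show k + m - 2 = (k - 1) + (m - 1) by ring]
    exact (norm_add_le _ _).trans (by linarith)
  set d := k + m - 2 with hd
  have h1 : ∀ c w : ℂ, ‖w‖ < ‖c‖ → c + w ≠ 0 := fun c w hw h0 => by
    rw [eq_neg_of_add_eq_zero_left h0, norm_neg] at hw
    exact lt_irrefl _ hw
  refine mul_ne_zero (mul_ne_zero (mul_ne_zero ?_ ?_) ?_)
    (mul_ne_zero (Complex.exp_ne_zero _) (Complex.exp_ne_zero _))
  · rw [show (k + m) / 2 = 1 + d / 2 by rw [hd]; ring]
    refine h1 _ _ ?_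
    rw [norm_div, norm_one, Complex.norm_two]; linarith
  · rw [show k + m + 2 * (1 / 2) = 3 + d by rw [hd]; ring]
    refine h1 _ _ ?_
    rw [Complex.norm_ofNat]; linarith
  · rw [show (k + m) ^ 2 + 2 * (1 / 2) * (k + m) + 4 * (1 / 2) ^ 2 - 4 = 3 + (5 + d) * d by
      rw [hd]; ring]
    refine h1 _ _ ?_
    rw [Complex.norm_ofNat, norm_mul]
    have h5 : ‖5 + d‖ ≤ 6 := (norm_add_le _ _).trans (by rw [Complex.norm_ofNat]; linarith)
    nlinarith [norm_nonneg d, norm_nonneg (5 + d)]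

/-- Every decaying solution is a combination of the two explicit ones. -/
theorem DecaySol.exists_eq_jost {l k m : ℂ} {x₀ : ℝ} {a a₁ b b₁ : ℝ → ℂ}
    (h : DecaySol l x₀ a a₁ b b₁) (hkl : k ^ 2 = 1 - 2 * l) (hml : m ^ 2 = 1 + 2 * l)
    (hk : ‖k - 1‖ ≤ 1 / 8) (hm : ‖m - 1‖ ≤ 1 / 8) (hx₀ : x₀ < Real.artanh (1 / 2)) :
    ∃ c d : ℂ, ∀ x > 0, a x = c * jostA k (x + x₀) + d * jostA m (x + x₀) ∧
      a₁ x = c * jostA₁ k (x + x₀) + d * jostA₁ m (x + x₀) ∧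
      b x = c * jostB k (x + x₀) - d * jostB m (x + x₀) ∧
      b₁ x = c * jostB₁ k (x + x₀) - d * jostB₁ m (x + x₀) := by
  have J1 := DecaySol.jost (half_le_re hk) hkl x₀
  have J2 := (DecaySol.jost (l := -l) (half_le_re hm) (by rw [hml]; ring) x₀).neg_snd
  rw [neg_neg] at J2
  set y := Real.artanh (1 / 2) with hy
  have hT : th y = 1 / 2 := by
    rw [th, hy, Real.tanh_artanh (by norm_num)]
    norm_num
  have hdet := jost_det_ne_zero (by rw [hkl, hml]; ring) hk hm hT
  set Δ := jostA k y * jostB m y + jostA m y * jostB k y with hΔ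
  set t := y - x₀ with ht
  have hty : t + x₀ = y := by ring
  set c := (a t * jostB m y + b t * jostA m y) / Δ with hc
  -- Cramer's rule: $c$ and $d$ match the values of both components at $t$, and the remainder `R`
  -- vanishes there.
  set d := (a t * jostB k y - b t * jostA k y) / Δ with hd
  have hcΔ : c * Δ = a t * jostB m y + b t * jostA m y := div_mul_cancel₀ _ hdet
  have hdΔ : d * Δ = a t * jostB k y - b t * jostA k y := div_mul_cancel₀ _ hdet
  have R := (h.add_smul J1 (-c)).add_smul J2 (-d)
  have tpos : 0 < t := sub_pos.2 hx₀
  have ea : a t + -c * jostA k (t + x₀) + -d * jostA m (t + x₀) = 0 := by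
    rw [hty]
    refine (mul_eq_zero.1 (?_ : Δ * _ = 0)).resolve_left hdet
    rw [hΔ] at *
    linear_combination (-jostA k y) * hcΔ - jostA m y * hdΔ
  have eb : b t + -c * jostB k (t + x₀) + -d * -jostB m (t + x₀) = 0 := by
    rw [hty]
    refine (mul_eq_zero.1 (?_ : Δ * _ = 0)).resolve_left hdet
    rw [hΔ] at *
    linear_combination (-jostB k y) * hcΔ + jostB m y * hdΔ
  -- With the values of `R` zero at $t$, its Wronskians against the two explicit solutions form a
  -- linear system for its derivatives, with determinant $\pm\Delta$. So the derivatives vanish too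
  -- and ODE uniqueness applies.
  have w1 := R.wronskian_eq_zero J1 tpos
  have w2 := R.wronskian_eq_zero J2 tpos
  beta_reduce at w1 w2
  rw [ea, eb, hty] at w1 w2
  have z := R.eq_zero tpos ⟨ea,
    (mul_eq_zero.1 (?_ : Δ * _ = 0)).resolve_left hdet, eb,
    (mul_eq_zero.1 (?_ : Δ * _ = 0)).resolve_left hdet⟩
  · refine ⟨c, d, fun x hx => ?_⟩
    obtain ⟨z1, z2, z3, z4⟩ := z x hx
    exact ⟨by linear_combination z1, by linear_combination z2, by linear_combination z3,
      by linear_combination z4⟩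
  · rw [hΔ, hty]
    linear_combination jostB m y * w1 + jostB k y * w2
  · rw [hΔ, hty]
    linear_combination jostA m y * w1 - jostA k y * w2

/-! ### Regularity and symmetry on the domain of the point interaction. -/

/-- Functions in the domain whose second derivative is a classical one off the origin. -/
structure InDomainC2 (q : ℝ) (f f₁ f₂ : ℝ → ℂ) : Prop extends InDomain q f f₁ f₂ where
  hasDerivAt_one : ∀ x : ℝ, x ≠ 0 → HasDerivAt f₁ (f₂ x) x

theorem ae_ne_zero : ∀ᵐ x : ℝ, x ≠ 0 := by simp [ae_iff, measure_singleton]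

/-- Elliptic regularity: in the eigenvalue equation $f''$ equals almost everywhere an expression
continuous off the origin, so the weak equation becomes a classical ODE. -/
theorem InDomain.inDomainC2 {q : ℝ} {f f₁ f₂ h : ℝ → ℂ} (hf : InDomain q f f₁ f₂)
    (he : f₂ =ᵐ[volume] h) (hc : ∀ x ≠ 0, ContinuousAt h x) : InDomainC2 q f f₁ h := by
  have hm : MemLp h 2 volume := hf.memLp_two.ae_eq he
  have hi : ∀ a b : ℝ, (0 : ℝ) ∉ Set.uIcc a b → f₁ b - f₁ a = ∫ t in a..b, h t := fun a b h0 => by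
    rw [hf.sub_eq_integral a b h0]
    exact intervalIntegral.integral_congr_ae (he.mono fun x hx _ => hx)
  refine { hf with memLp_two := hm, sub_eq_integral := hi, hasDerivAt_one := fun x hx => ?_ }
  have hd := intervalIntegral.integral_hasDerivAt_right
    (IntervalIntegrable.refl : IntervalIntegrable h volume x x)
    hm.aestronglyMeasurable.stronglyMeasurableAtFilter (hc x hx)
  refine (hd.const_add (f₁ x)).congr_of_eventuallyEq ?_
  obtain ⟨ε, hε, hb⟩ := Metric.isOpen_iff.1 isOpen_ne x hx
  filter_upwards [Metric.ball_mem_nhds x hε] with y hy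
  have hsub : Set.uIcc x y ⊆ Metric.ball x ε := by
    rw [← segment_eq_uIcc]
    exact (convex_ball x ε).segment_subset (Metric.mem_ball_self hε) hy
  rw [← hi x y fun h0 => hb (hsub h0) rfl]
  ring

theorem InDomain.continuous {q : ℝ} {f f₁ f₂ : ℝ → ℂ} (hf : InDomain q f f₁ f₂) :
    Continuous f :=
  continuous_iff_continuousAt.2 fun x => by
    by_cases hx : x = 0
    · rw [hx]; exact hf.continuousAt_zero
    · exact (hf.hasDerivAt x hx).continuousAt

namespace InDomainC2

variable {q : ℝ} {f f₁ f₂ g g₁ g₂ : ℝ → ℂ}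

theorem reflect (hf : InDomainC2 q f f₁ f₂) :
    InDomainC2 q (fun x => f (-x)) (fun x => -f₁ (-x)) (fun x => f₂ (-x)) where
  memLp := hf.memLp.comp_measurePreserving (Measure.measurePreserving_neg volume)
  memLp_one := (hf.memLp_one.comp_measurePreserving (Measure.measurePreserving_neg volume)).neg
  memLp_two := hf.memLp_two.comp_measurePreserving (Measure.measurePreserving_neg volume)
  hasDerivAt x hx := by
    have := (hf.hasDerivAt (-x) (neg_ne_zero.2 hx)).scomp x (hasDerivAt_neg x)
    exact this.congr_deriv (by simp)
  hasDerivAt_one x hx := by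
    have := (hf.hasDerivAt_one (-x) (neg_ne_zero.2 hx)).scomp x (hasDerivAt_neg x)
    exact this.neg.congr_deriv (by simp)
  sub_eq_integral a b h := by
    rw [intervalIntegral.integral_comp_neg, ← hf.sub_eq_integral]
    · ring
    · intro h0
      apply h
      rw [Set.mem_uIcc] at h0 ⊢
      rcases h0 with h0 | h0
      · left; constructor <;> linarith [h0.1, h0.2]
      · right; constructor <;> linarith [h0.1, h0.2]
  continuousAt_zero := (hf.continuous.comp continuous_neg).continuousAt
  jump := by
    obtain ⟨a, b, ha, hb, hab⟩ := hf.jump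
    refine ⟨-b, -a, ?_, ?_, by simp only [neg_zero]; linear_combination hab⟩
    · refine (hb.comp (tendsto_nhdsWithin_iff.2 ⟨?_, ?_⟩)).neg
      · simpa using (continuous_neg.tendsto (0 : ℝ)).mono_left nhdsWithin_le_nhds
      · filter_upwards [self_mem_nhdsWithin] with x hx
        simpa using hx
    · refine (ha.comp (tendsto_nhdsWithin_iff.2 ⟨?_, ?_⟩)).neg
      · simpa using (continuous_neg.tendsto (0 : ℝ)).mono_left nhdsWithin_le_nhds
      · filter_upwards [self_mem_nhdsWithin] with x hx
        simpa using hx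

theorem tendsto (hf : InDomainC2 q f f₁ f₂) : Tendsto f atTop (𝓝 0) :=
  tendsto_zero_of_memLp (fun x hx => hf.hasDerivAt x hx.ne') (hf.memLp.restrict _)
    (hf.memLp_one.restrict _)

theorem tendsto_one (hf : InDomainC2 q f f₁ f₂) : Tendsto f₁ atTop (𝓝 0) :=
  tendsto_zero_of_memLp (fun x hx => hf.hasDerivAt_one x hx.ne') (hf.memLp_one.restrict _)
    (hf.memLp_two.restrict _)

/-- Symmetry of the second derivative with a point interaction. -/
theorem integral_eq_zero (hf : InDomainC2 q f f₁ f₂) (hg : InDomainC2 q g g₁ g₂) :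
    ∫ x, (f₂ x * g x - f x * g₂ x) = 0 := by
  obtain ⟨a, b, ha, hb, hab⟩ := hf.jump
  obtain ⟨c, d, hc, hd, hcd⟩ := hg.jump
  have hi : Integrable (fun x => f₂ x * g x - f x * g₂ x) :=
    (hf.memLp_two.integrable_mul hg.memLp).sub (hf.memLp.integrable_mul hg.memLp_two)
  set W : ℝ → ℂ := fun x => f₁ x * g x - f x * g₁ x with hW
  -- The jump of the Wronskian at $0$ is $-2qf(0)g(0)+2qf(0)g(0)=0$, so `U` is its continuous
  -- extension and the fundamental theorem applies across the origin.
  set U := Function.update W 0 (a * g 0 - f 0 * c) with hU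
  have hUW : ∀ x ≠ 0, U x = W x := fun x hx => Function.update_of_ne hx _ _
  have hUd : ∀ x ≠ 0, HasDerivAt U (f₂ x * g x - f x * g₂ x) x := fun x hx => by
    have h1 : HasDerivAt W (f₂ x * g x - f x * g₂ x) x :=
      (((hf.hasDerivAt_one x hx).mul (hg.hasDerivAt x hx)).sub
        ((hf.hasDerivAt x hx).mul (hg.hasDerivAt_one x hx))).congr_deriv (by ring)
    refine h1.congr_of_eventuallyEq ?_
    filter_upwards [isOpen_ne.mem_nhds hx] with y hy using hUW y hy
  have hf0 := hf.continuousAt_zero.tendsto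
  have hg0 := hg.continuousAt_zero.tendsto
  have hUc : Continuous U := continuous_iff_continuousAt.2 fun x => by
    by_cases hx : x = 0
    · subst hx
      rw [continuousAt_iff_punctured_nhds, ← nhdsLT_sup_nhdsGT, tendsto_sup]
      have e0 : U 0 = a * g 0 - f 0 * c := Function.update_self _ _ _
      constructor
      · have : Tendsto W (𝓝[<] 0) (𝓝 (b * g 0 - f 0 * d)) :=
          (hb.mul (hg0.mono_left nhdsWithin_le_nhds)).sub
            ((hf0.mono_left nhdsWithin_le_nhds).mul hd)
        rw [e0, show a * g 0 - f 0 * c = b * g 0 - f 0 * d by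
          linear_combination g 0 * hab - f 0 * hcd]
        refine this.congr' ?_
        filter_upwards [self_mem_nhdsWithin] with y hy using (hUW y (ne_of_lt hy)).symm
      · have : Tendsto W (𝓝[>] 0) (𝓝 (a * g 0 - f 0 * c)) :=
          (ha.mul (hg0.mono_left nhdsWithin_le_nhds)).sub
            ((hf0.mono_left nhdsWithin_le_nhds).mul hc)
        rw [e0]
        refine this.congr' ?_
        filter_upwards [self_mem_nhdsWithin] with y hy using (hUW y (ne_of_gt hy)).symm
    · exact (hUd x hx).continuousAt
  have hint : ∀ r : ℝ, ∫ x in -r..r, (f₂ x * g x - f x * g₂ x) = U r - U (-r) := fun r =>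
    MeasureTheory.integral_eq_of_hasDerivAt_off_countable U _ (Set.countable_singleton 0)
      hUc.continuousOn (fun x hx => hUd x hx.2) hi.intervalIntegrable
  have h1 := intervalIntegral_tendsto_integral hi tendsto_neg_atTop_atBot tendsto_id
  refine tendsto_nhds_unique h1 ?_
  have t1 : Tendsto (fun x => W x) atTop (𝓝 0) := by
    simpa using (hf.tendsto_one.mul hg.tendsto).sub (hf.tendsto.mul hg.tendsto_one)
  have t2 : Tendsto (fun x => W (-x)) atTop (𝓝 0) := by
    have := (hf.reflect.tendsto_one.mul hg.reflect.tendsto).sub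
      (hf.reflect.tendsto.mul hg.reflect.tendsto_one)
    have := this.neg
    simp only [mul_zero, sub_zero, neg_zero] at this
    refine this.congr fun x => ?_
    simp only [hW]; ring
  have t3 : Tendsto (fun x => W x - W (-x)) atTop (𝓝 0) := by simpa using t1.sub t2
  refine t3.congr' ?_
  filter_upwards [eventually_gt_atTop 0] with x hx
  rw [id, hint, hUW x hx.ne', hUW (-x) (neg_ne_zero.2 hx.ne')]

end InDomainC2

/-! ### The eigenvalue equation as an ODE system with matching conditions at the origin. -/

theorem groundState_one (q x : ℝ) :
    (groundState q 1 x : ℂ) = sech (|x| + Real.artanh q) := by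
  simp [groundState, sech]

theorem groundState_one_sq (q x : ℝ) :
    (groundState q 1 x : ℂ) ^ 2 = 1 - th (|x| + Real.artanh q) ^ 2 := by
  rw [groundState_one, sech_sq]

theorem F_eq_iff (q : ℝ) (u w : L2 × L2) :
    (∃ h : u ∈ (F q).domain, F q ⟨u, h⟩ = w) ↔
      (u.2, w.1) ∈ (Lminus q).graph ∧ (u.1, -w.2) ∈ (Lplus q).graph := by
  constructor
  · rintro ⟨h, rfl⟩
    refine ⟨(LinearPMap.mem_graph_iff _).2 ⟨⟨u.2, h.2⟩, rfl, rfl⟩,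
      (LinearPMap.mem_graph_iff _).2 ⟨⟨u.1, h.1⟩, rfl, (neg_neg _).symm⟩⟩
  · rintro ⟨hm, hp⟩
    obtain ⟨⟨y, hy⟩, h1, h1'⟩ := (LinearPMap.mem_graph_iff _).1 hm
    obtain ⟨⟨y', hy'⟩, h2, h2'⟩ := (LinearPMap.mem_graph_iff _).1 hp
    obtain ⟨u1, u2⟩ := u
    simp only at h1 h2
    subst h1
    subst h2
    exact ⟨⟨hy', hy⟩, Prod.ext h1' (neg_eq_iff_eq_neg.2 h2')⟩

/-- Functions that represent a solution of `F u - z u = r`. -/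
structure FRep (q : ℝ) (z : ℂ) (ρ₁ ρ₂ f f₁ g g₁ : ℝ → ℂ) : Prop where
  fst : InDomainC2 q f f₁ fun x =>
    (1 - 6 * (1 - th (|x| + Real.artanh q) ^ 2)) * f x + 2 * (z * g x + ρ₂ x)
  snd : InDomainC2 q g g₁ fun x =>
    (1 - 2 * (1 - th (|x| + Real.artanh q) ^ 2)) * g x - 2 * (z * f x + ρ₁ x)

theorem exists_fRep {q : ℝ} {z : ℂ} {u r : L2 × L2} {ρ₁ ρ₂ : ℝ → ℂ}
    (h : ∃ h : u ∈ (F q).domain, F q ⟨u, h⟩ - z • u = r)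
    (h1 : r.1 =ᵐ[volume] ρ₁) (h2 : r.2 =ᵐ[volume] ρ₂)
    (c1 : ∀ x ≠ 0, ContinuousAt ρ₁ x) (c2 : ∀ x ≠ 0, ContinuousAt ρ₂ x) :
    ∃ f f₁ g g₁, u.1 =ᵐ[volume] f ∧ u.2 =ᵐ[volume] g ∧ FRep q z ρ₁ ρ₂ f f₁ g g₁ := by
  have h' : ∃ h : u ∈ (F q).domain, F q ⟨u, h⟩ = r + z • u := by
    obtain ⟨hu, h⟩ := h
    exact ⟨hu, eq_add_of_sub_eq h⟩
  obtain ⟨hm, hp⟩ := (F_eq_iff q u _).1 h'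
  obtain ⟨g, g₁, g₂, hg, hug, hkg⟩ := (mem_graph_schrodinger _ _ _).1 hm
  obtain ⟨f, f₁, f₂, hf, huf, hkf⟩ := (mem_graph_schrodinger _ _ _).1 hp
  have hT : Continuous fun x => th (|x| + Real.artanh q) :=
    continuous_th.comp (continuous_abs.add continuous_const)
  refine ⟨f, f₁, g, g₁, huf, hug, hf.inDomainC2 ?_ ?_, hg.inDomainC2 ?_ ?_⟩
  · simp only [Prod.snd_add, Prod.smul_snd] at hkf
    filter_upwards [hkf, hug, h2, Lp.coeFn_neg (r.2 + z • u.2), Lp.coeFn_add r.2 (z • u.2),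
      Lp.coeFn_smul z u.2] with x e1 e2 e3 e4 e5 e6
    rw [e4, Pi.neg_apply, e5, Pi.add_apply, e6, Pi.smul_apply, e2, e3, smul_eq_mul] at e1
    push_cast at e1
    rw [groundState_one_sq] at e1
    linear_combination 2 * e1
  · intro x hx
    have := c2 x hx
    have := hf.continuous
    have := hT.continuousAt (x := x)
    have := hg.continuous
    exact (ContinuousAt.mul (by fun_prop) (by fun_prop)).add
      (ContinuousAt.mul (by fun_prop) (by fun_prop))
  · simp only [Prod.fst_add, Prod.smul_fst] at hkg
    filter_upwards [hkg, huf, h1, Lp.coeFn_add r.1 (z • u.1),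
      Lp.coeFn_smul z u.1] with x e1 e2 e3 e5 e6
    rw [e5, Pi.add_apply, e6, Pi.smul_apply, e2, e3, smul_eq_mul] at e1
    push_cast at e1
    rw [groundState_one_sq] at e1
    linear_combination 2 * e1
  · intro x hx
    have := c1 x hx
    have := hf.continuous
    have := hT.continuousAt (x := x)
    have := hg.continuous
    exact (ContinuousAt.mul (by fun_prop) (by fun_prop)).sub
      (ContinuousAt.mul (by fun_prop) (by fun_prop))

theorem F_eq_of_inDomain {q : ℝ} {u w : L2 × L2} {κ₁ κ₂ f f₁ f₂ g g₁ g₂ : ℝ → ℂ}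
    (hu : u.1 =ᵐ[volume] f) (hv : u.2 =ᵐ[volume] g)
    (h1 : w.1 =ᵐ[volume] κ₁) (h2 : w.2 =ᵐ[volume] κ₂)
    (hf : InDomain q f f₁ f₂) (hg : InDomain q g g₁ g₂)
    (ef : ∀ x ≠ 0, f₂ x = (1 - 6 * (1 - th (|x| + Real.artanh q) ^ 2)) * f x + 2 * κ₂ x)
    (eg : ∀ x ≠ 0, g₂ x = (1 - 2 * (1 - th (|x| + Real.artanh q) ^ 2)) * g x - 2 * κ₁ x) :
    ∃ h : u ∈ (F q).domain, F q ⟨u, h⟩ = w := by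
  refine (F_eq_iff q u w).2 ⟨(mem_graph_schrodinger _ _ _).2 ⟨g, g₁, g₂, hg, hv, ?_⟩,
    (mem_graph_schrodinger _ _ _).2 ⟨f, f₁, f₂, hf, hu, ?_⟩⟩
  · filter_upwards [h1, ae_ne_zero] with x e1 hx
    push_cast
    rw [e1, groundState_one_sq, eg x hx]
    ring
  · filter_upwards [h2, ae_ne_zero, Lp.coeFn_neg w.2] with x e1 hx e2
    simp only [e2, Pi.neg_apply, e1, ef x hx]
    push_cast
    rw [groundState_one_sq]
    ring

/-- The operator $\partial+\tanh$ annihilates $\mathrm{sech}$ and is a factor of $L_-$. At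
$y=\tanh^{-1}q$ it is also the even boundary operator $A'+qA$, so this identity and `jostB₁_add_mul`
evaluate the even matching conditions. -/
theorem jostA₁_add_mul (k : ℂ) (y : ℝ) :
    jostA₁ k y + th y * jostA k y =
      (k + th y) * (3 - 2 * th y ^ 2 - k ^ 2) * Complex.exp (-(k * y)) := by
  rw [jostA, jostA₁]; ring

theorem jostB₁_add_mul (k : ℂ) (y : ℝ) :
    jostB₁ k y + th y * jostB k y = (1 - k ^ 2) * (k + th y) * Complex.exp (-(k * y)) := by
  rw [jostB, jostB₁]; ring

theorem continuous_jostA (k : ℂ) : Continuous (jostA k) :=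
  continuous_iff_continuousAt.2 fun y => (hasDerivAt_jostA k y).continuousAt

theorem continuous_jostB (k : ℂ) : Continuous (jostB k) :=
  continuous_iff_continuousAt.2 fun y => (hasDerivAt_jostB k y).continuousAt

theorem continuous_jostA₁ (k : ℂ) : Continuous (jostA₁ k) :=
  continuous_iff_continuousAt.2 fun y => (hasDerivAt_jostA₁ k y).continuousAt

theorem continuous_jostB₁ (k : ℂ) : Continuous (jostB₁ k) :=
  continuous_iff_continuousAt.2 fun y => (hasDerivAt_jostB₁ k y).continuousAt

theorem eq_of_tendsto_right {φ Φ : ℝ → ℂ} {L : ℂ} (hφ : Tendsto φ (𝓝[>] 0) (𝓝 L))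
    (hΦ : Continuous Φ) (h : ∀ x > 0, φ x = Φ x) : L = Φ 0 := by
  refine tendsto_nhds_unique hφ (((hΦ.tendsto 0).mono_left nhdsWithin_le_nhds).congr' ?_)
  filter_upwards [self_mem_nhdsWithin] with x hx using (h x hx).symm

namespace FRep

variable {q : ℝ} {z l : ℂ} {f f₁ g g₁ : ℝ → ℂ}

theorem reflect (h : FRep q z 0 0 f f₁ g g₁) :
    FRep q z 0 0 (fun x => f (-x)) (fun x => -f₁ (-x)) (fun x => g (-x))
      (fun x => -g₁ (-x)) where
  fst := by simpa using h.fst.reflect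
  snd := by simpa using h.snd.reflect

theorem decaySol (h : FRep q (Complex.I * l) 0 0 f f₁ g g₁) :
    DecaySol l (Real.artanh q) f f₁ (fun x => -Complex.I * g x) (fun x => -Complex.I * g₁ x) where
  ha x hx := h.fst.hasDerivAt x hx.ne'
  hb x hx := (h.snd.hasDerivAt x hx.ne').const_mul _
  ha₁ x hx := (h.fst.hasDerivAt_one x hx.ne').congr_deriv (by
    rw [abs_of_pos hx]; simp only [Pi.zero_apply]; ring)
  hb₁ x hx := ((h.snd.hasDerivAt_one x hx.ne').const_mul _).congr_deriv (by
    rw [abs_of_pos hx]; simp only [Pi.zero_apply]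
    linear_combination 2 * l * f x * Complex.I_sq)
  ta := h.fst.tendsto
  tb := by simpa using h.snd.tendsto.const_mul (-Complex.I)
  ta₁ := h.fst.tendsto_one
  tb₁ := by simpa using h.snd.tendsto_one.const_mul (-Complex.I)

/-- Solutions of the eigenvalue equation, with their even (`e`, `d`) and odd (`o`, `p`)
coefficients, and the conditions at the origin. -/
theorem exists_coeff (h : FRep q (Complex.I * l) 0 0 f f₁ g g₁) {k m : ℂ}
    (hkl : k ^ 2 = 1 - 2 * l) (hml : m ^ 2 = 1 + 2 * l)
    (hk : ‖k - 1‖ ≤ 1 / 8) (hm : ‖m - 1‖ ≤ 1 / 8) (hq : |q| < 1 / 2) :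
    ∃ e d o p : ℂ,
      e * (jostA₁ k (Real.artanh q) + q * jostA k (Real.artanh q)) +
        d * (jostA₁ m (Real.artanh q) + q * jostA m (Real.artanh q)) = 0 ∧
      e * (jostB₁ k (Real.artanh q) + q * jostB k (Real.artanh q)) -
        d * (jostB₁ m (Real.artanh q) + q * jostB m (Real.artanh q)) = 0 ∧
      o * jostA k (Real.artanh q) + p * jostA m (Real.artanh q) = 0 ∧
      o * jostB k (Real.artanh q) - p * jostB m (Real.artanh q) = 0 ∧
      ∀ x > 0,
        f x = (e + o) * jostA k (x + Real.artanh q) + (d + p) * jostA m (x + Real.artanh q) ∧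
        f (-x) = (e - o) * jostA k (x + Real.artanh q) + (d - p) * jostA m (x + Real.artanh q) ∧
        g x = Complex.I *
          ((e + o) * jostB k (x + Real.artanh q) - (d + p) * jostB m (x + Real.artanh q)) ∧
        g (-x) = Complex.I *
          ((e - o) * jostB k (x + Real.artanh q) - (d - p) * jostB m (x + Real.artanh q)) := by
  set y := Real.artanh q with hy
  rw [abs_lt] at hq
  have hx₀ : y < Real.artanh (1 / 2) :=
    Real.artanh_lt_artanh (by linarith) (by norm_num) hq.2
  obtain ⟨c, d, hr⟩ := h.decaySol.exists_eq_jost hkl hml hk hm hx₀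
  obtain ⟨c', d', hl⟩ := h.reflect.decaySol.exists_eq_jost hkl hml hk hm hx₀
  obtain ⟨a, b, ha, hb, hab⟩ := h.fst.jump
  obtain ⟨α, β, hα, hβ, hαβ⟩ := h.snd.jump
  have hneg : Tendsto (fun x : ℝ => -x) (𝓝[>] 0) (𝓝[<] 0) := by
    refine tendsto_nhdsWithin_iff.2 ⟨?_, ?_⟩
    · simpa using (continuous_neg.tendsto (0 : ℝ)).mono_left nhdsWithin_le_nhds
    · filter_upwards [self_mem_nhdsWithin] with x hx
      simpa using hx
  have hadd : Continuous fun x : ℝ => x + y := continuous_add_const y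
  have cA := fun k => (continuous_jostA k).comp hadd
  have cB := fun k => (continuous_jostB k).comp hadd
  have cA₁ := fun k => (continuous_jostA₁ k).comp hadd
  have cB₁ := fun k => (continuous_jostB₁ k).comp hadd
  have r1 := eq_of_tendsto_right (h.fst.continuousAt_zero.tendsto.mono_left nhdsWithin_le_nhds)
    (((cA k).const_mul c).add ((cA m).const_mul d)) (fun x hx => (hr x hx).1)
  have r2 := eq_of_tendsto_right ha
    (((cA₁ k).const_mul c).add ((cA₁ m).const_mul d)) (fun x hx => (hr x hx).2.1)
  have r3 := eq_of_tendsto_right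
    ((h.snd.continuousAt_zero.tendsto.mono_left nhdsWithin_le_nhds).const_mul (-Complex.I))
    (((cB k).const_mul c).sub ((cB m).const_mul d)) (fun x hx => (hr x hx).2.2.1)
  have r4 := eq_of_tendsto_right (hα.const_mul (-Complex.I))
    (((cB₁ k).const_mul c).sub ((cB₁ m).const_mul d)) (fun x hx => (hr x hx).2.2.2)
  have l1 := eq_of_tendsto_right
    ((h.fst.continuousAt_zero.tendsto.mono_left nhdsWithin_le_nhds).comp hneg)
    (((cA k).const_mul c').add ((cA m).const_mul d')) (fun x hx => (hl x hx).1)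
  have l2 := eq_of_tendsto_right (hb.comp hneg).neg
    (((cA₁ k).const_mul c').add ((cA₁ m).const_mul d')) (fun x hx => (hl x hx).2.1)
  have l3 := eq_of_tendsto_right
    (((h.snd.continuousAt_zero.tendsto.mono_left nhdsWithin_le_nhds).comp hneg).const_mul
      (-Complex.I))
    (((cB k).const_mul c').sub ((cB m).const_mul d')) (fun x hx => (hl x hx).2.2.1)
  have l4 := eq_of_tendsto_right ((hβ.comp hneg).neg.const_mul (-Complex.I))
    (((cB₁ k).const_mul c').sub ((cB₁ m).const_mul d')) (fun x hx => (hl x hx).2.2.2)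
  simp only [Function.comp, Pi.add_apply, Pi.sub_apply, zero_add] at r1 r2 r3 r4 l1 l2 l3 l4
  -- Unprimed coefficients describe the right half-line, primed ones the reflected left half-line.
  -- Half-sums give the even part, constrained by the jump; half-differences give the odd part,
  -- constrained by continuity.
  refine ⟨(c + c') / 2, (d + d') / 2, (c - c') / 2, (d - d') / 2, ?_, ?_, ?_, ?_, ?_⟩
  · linear_combination (-1 / 2) * r2 - 1 / 2 * l2 + 1 / 2 * hab - q / 2 * (r1 + l1)
  · linear_combination (-1 / 2) * r4 - 1 / 2 * l4 - Complex.I / 2 * hαβ - q / 2 * (r3 + l3)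
  · linear_combination (-1 / 2) * r1 + 1 / 2 * l1
  · linear_combination (-1 / 2) * r3 + 1 / 2 * l3
  · intro x hx
    obtain ⟨R1, -, R2, -⟩ := hr x hx
    obtain ⟨L1, -, L2, -⟩ := hl x hx
    refine ⟨by linear_combination R1, by linear_combination L1, ?_, ?_⟩
    · linear_combination Complex.I * R2 + g x * Complex.I_sq
    · linear_combination Complex.I * L2 + g (-x) * Complex.I_sq

/-- The solvability condition: if `(F - z) u = γ w` with `F w = z w` and `w = (a, b)`, then
`γ ∫ a b = 0`. -/
theorem mul_integral_eq_zero {γ : ℂ} {a a₁ b b₁ : ℝ → ℂ}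
    (h : FRep q z (fun x => γ * a x) (fun x => γ * b x) f f₁ g g₁)
    (H : FRep q z 0 0 a a₁ b b₁) : γ * ∫ x, a x * b x = 0 := by
  have e1 := h.fst.integral_eq_zero H.fst
  have e2 := h.snd.integral_eq_zero H.snd
  have i1 : Integrable fun x => g x * a x := h.snd.memLp.integrable_mul H.fst.memLp
  have i2 : Integrable fun x => a x * b x := H.fst.memLp.integrable_mul H.snd.memLp
  have i3 : Integrable fun x => f x * b x := h.fst.memLp.integrable_mul H.snd.memLp
  have i4 : Integrable fun x => 2 * z * (g x * a x - f x * b x) := (i1.sub i3).const_mul _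
  -- The two symmetry identities share their $z$-term and carry opposite signs on $\gamma ab$; their
  -- difference isolates $\gamma\int ab$.
  have s1 : ∫ x, (2 * z * (g x * a x - f x * b x) + 2 * γ * (a x * b x)) = 0 := by
    rw [← e1]
    congr 1; ext x; simp only [Pi.zero_apply]; ring
  have s2 : ∫ x, (2 * z * (g x * a x - f x * b x) - 2 * γ * (a x * b x)) = 0 := by
    rw [← e2]
    congr 1; ext x; simp only [Pi.zero_apply]; ring
  rw [integral_add i4 (i2.const_mul _), integral_const_mul,
    integral_const_mul] at s1
  rw [integral_sub i4 (i2.const_mul _), integral_const_mul,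
    integral_const_mul] at s2
  linear_combination (s1 - s2) / 4

end FRep

/-! ### The odd determinant and the equation for the eigenvalues. -/

/-- For the root with nonnegative real part, $|k+1|\ge1$ in $w=(k-1)(k+1)$. -/
theorem exists_sq_eq_one_add (w : ℂ) : ∃ k : ℂ, k ^ 2 = 1 + w ∧ ‖k - 1‖ ≤ ‖w‖ := by
  obtain ⟨k, hk, hre⟩ : ∃ k : ℂ, k ^ 2 = 1 + w ∧ 0 ≤ k.re := by
    obtain ⟨k, hk⟩ := IsAlgClosed.exists_pow_nat_eq (1 + w) (n := 2) (by norm_num)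
    rcases le_total 0 k.re with h | h
    · exact ⟨k, hk, h⟩
    · exact ⟨-k, by rw [neg_sq, hk], by simpa using h⟩
  refine ⟨k, hk, ?_⟩
  have h1 : w = (k - 1) * (k + 1) := by linear_combination -hk
  have h2 : 1 ≤ ‖k + 1‖ := by
    have := (le_abs_self _).trans (Complex.abs_re_le_norm (k + 1))
    simp at this
    linarith
  rw [h1, norm_mul]
  exact le_mul_of_one_le_right (norm_nonneg _) h2

theorem th_artanh {q : ℝ} (hq : |q| < 1) : th (Real.artanh q) = q := by
  rw [th, Real.tanh_artanh (abs_lt.1 hq)]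

theorem add_ne_zero_of_norm_lt {c w : ℂ} (h : ‖w‖ < ‖c‖) : c + w ≠ 0 := fun h0 => by
  rw [eq_neg_of_add_eq_zero_left h0, norm_neg] at h
  exact lt_irrefl _ h

/-- The square of the nonzero eigenvalues of `-i F` near the origin. -/
def eigSq (q : ℝ) : ℝ := q * (1 - q ^ 2) * (√(4 - 3 * q ^ 2) - q) / 2

section Root

variable {q : ℝ}

theorem sq_root_eq (hq : |q| < 1 / 100) : √(4 - 3 * q ^ 2) ^ 2 = 4 - 3 * q ^ 2 := by
  refine Real.sq_sqrt ?_
  rw [abs_lt] at hq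
  nlinarith

theorem root_bounds (hq : |q| < 1 / 100) :
    √(4 - 3 * q ^ 2) ≤ 2 ∧ 2 - |q| ≤ √(4 - 3 * q ^ 2) := by
  have h0 := abs_nonneg q
  have h2 := sq_abs q
  constructor
  · exact Real.sqrt_le_iff.2 ⟨by norm_num, by nlinarith [sq_nonneg q]⟩
  · exact Real.le_sqrt_of_sq_le (by nlinarith)

theorem abs_eigSq_sub_le (hq : |q| < 1 / 100) : |eigSq q - q| ≤ 2 * q ^ 2 := by
  obtain ⟨h1, h2⟩ := root_bounds hq
  set r := √(4 - 3 * q ^ 2) with hr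
  have h0 := abs_nonneg q
  have e : eigSq q - q = q * ((1 - q ^ 2) * ((r - q) / 2) - 1) := by
    rw [eigSq]; ring
  have h3 : |(1 - q ^ 2) * ((r - q) / 2) - 1| ≤ 2 * |q| := by
    have hle := le_abs_self q
    have hge := neg_abs_le q
    have hs := sq_abs q
    rw [abs_le]
    constructor <;> nlinarith [sq_nonneg q]
  rw [e, abs_mul]
  nlinarith [mul_le_mul_of_nonneg_left h3 h0, sq_abs q]

theorem eigSq_ne_zero (hq : |q| < 1 / 100) (h0 : q ≠ 0) : eigSq q ≠ 0 := by
  intro h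
  have := abs_eigSq_sub_le hq
  rw [h, zero_sub, abs_neg, ← sq_abs q] at this
  nlinarith [abs_pos.2 h0]

/-- Dividing $||{\rm eigSq}|-|q||\le2q^2$ by the sum of the square roots, which is at least
$|q|^{1/2}$, leaves $2|q|^{3/2}$. -/
theorem abs_sqrt_abs_eigSq_sub_le (hq : |q| < 1 / 100) :
    |√(|eigSq q|) - √(|q|)| ≤ 2 * |q| ^ (3 / 2 : ℝ) := by
  rcases eq_or_ne q 0 with rfl | h0
  · simp [eigSq]
  have hp := abs_pos.2 h0
  have h1 : |(|eigSq q| - |q|)| ≤ 2 * |q| ^ 2 := by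
    rw [sq_abs]
    exact (abs_abs_sub_abs_le_abs_sub _ _).trans (abs_eigSq_sub_le hq)
  have hs := Real.sqrt_pos.2 hp
  have e : |eigSq q| - |q| = (√(|eigSq q|) - √(|q|)) * (√(|eigSq q|) + √(|q|)) := by
    linear_combination -Real.sq_sqrt (abs_nonneg (eigSq q)) + Real.sq_sqrt (abs_nonneg q)
  rw [e, abs_mul, abs_of_pos (by positivity : 0 < √(|eigSq q|) + √(|q|))] at h1
  have h2 : |q| ^ (3 / 2 : ℝ) * √(|q|) = |q| ^ 2 := by
    rw [Real.sqrt_eq_rpow, ← Real.rpow_add hp, ← Real.rpow_natCast]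
    norm_num
  have h3 : |√(|eigSq q|) - √(|q|)| * √(|q|) ≤ 2 * |q| ^ (3 / 2 : ℝ) * √(|q|) := by
    rw [mul_assoc, h2]
    refine le_trans (mul_le_mul_of_nonneg_left ?_ (abs_nonneg _)) h1
    linarith [Real.sqrt_nonneg |eigSq q|]
  exact le_of_mul_le_mul_right h3 hs

theorem eigSq_pos (hq : |q| < 1 / 100) (h0 : 0 < q) : 0 < eigSq q := by
  have := abs_eigSq_sub_le hq
  rw [abs_of_pos h0] at hq
  rw [abs_le] at this
  nlinarith [this.1]

theorem eigSq_neg (hq : |q| < 1 / 100) (h0 : q < 0) : eigSq q < 0 := by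
  have := abs_eigSq_sub_le hq
  rw [abs_of_neg h0] at hq
  rw [abs_le] at this
  nlinarith [this.2]

/-- The odd solutions are linearly dependent at the origin precisely at `l ^ 2 = eigSq q`. -/
theorem jost_det_eq_zero_iff (hq : |q| < 1 / 100) {l k m : ℂ}
    (hkl : k ^ 2 = 1 - 2 * l) (hml : m ^ 2 = 1 + 2 * l)
    (hk : ‖k - 1‖ ≤ 1 / 8) (hm : ‖m - 1‖ ≤ 1 / 8) :
    jostA k (Real.artanh q) * jostB m (Real.artanh q) +
      jostA m (Real.artanh q) * jostB k (Real.artanh q) = 0 ↔ l ^ 2 = eigSq q := by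
  have hs : k ^ 2 + m ^ 2 = 2 := by rw [hkl, hml]; ring
  rw [jost_det hs, th_artanh (hq.trans (by norm_num))]
  obtain ⟨hr2, hr1⟩ := root_bounds hq
  have hrr := sq_root_eq hq
  rw [eigSq]
  set r := √(4 - 3 * q ^ 2) with hr
  have hK : ‖k + m - 2‖ ≤ 1 / 4 := by
    rw [show k + m - 2 = (k - 1) + (m - 1) by ring]
    exact (norm_add_le _ _).trans (by linarith)
  have hqn : ‖(q : ℂ)‖ < 1 / 100 := by simpa using hq
  have hrn : ‖(r : ℂ) - 2‖ ≤ 1 / 100 := by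
    rw [show (r : ℂ) - 2 = ((r - 2 : ℝ) : ℂ) by push_cast; ring, Complex.norm_real,
      Real.norm_eq_abs, abs_le]
    constructor <;> linarith
  have hrc : (r : ℂ) ^ 2 = 4 - 3 * q ^ 2 := by exact_mod_cast hrr
  have hP : (k * m) ^ 2 = 1 - 4 * l ^ 2 := by rw [mul_pow, hkl, hml]; ring
  have hKP : (k + m) ^ 2 = 2 + 2 * (k * m) := by linear_combination hs
  have hkm : ‖k * m - 1‖ ≤ 3 / 10 := by
    rw [show k * m - 1 = (k - 1) * (m - 1) + ((k - 1) + (m - 1)) by ring]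
    refine (norm_add_le _ _).trans (add_le_add (b := 1 / 64) (d := 1 / 4) ?_
      ((norm_add_le _ _).trans (by linarith)) |>.trans (by norm_num))
    rw [norm_mul]
    nlinarith [norm_nonneg (k - 1), norm_nonneg (m - 1)]
  set K := k + m with hKdef
  have hK0 : K ≠ 0 := by
    rw [show K = 2 + (K - 2) by ring]
    refine add_ne_zero_of_norm_lt ?_
    rw [Complex.norm_ofNat]; linarith
  have hK1 : K + 2 * q ≠ 0 := by
    rw [show K + 2 * q = 2 + ((K - 2) + 2 * q) by ring]
    refine add_ne_zero_of_norm_lt ((norm_add_le _ _).trans_lt ?_)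
    rw [norm_mul, Complex.norm_ofNat]; linarith
  have hexp : Complex.exp (-(k * Real.artanh q)) * Complex.exp (-(m * Real.artanh q)) ≠ 0 :=
    mul_ne_zero (Complex.exp_ne_zero _) (Complex.exp_ne_zero _)
  rw [mul_eq_zero, or_iff_left hexp, mul_eq_zero,
    or_iff_right (mul_ne_zero (div_ne_zero hK0 two_ne_zero) hK1)]
  push_cast
  constructor
  · intro h
    -- The quadratic in $K$ has roots $-q\pm r$, and $K$ near $2$ selects $r-q$.
    have h1 : (K + q + r) * (K - (r - q)) = 0 := by linear_combination h - hrc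
    have h2 : K + q + r ≠ 0 := by
      rw [show K + q + r = 4 + ((K - 2) + (q + (r - 2))) by ring]
      refine add_ne_zero_of_norm_lt ((norm_add_le _ _).trans_lt ?_)
      have := norm_add_le (q : ℂ) (r - 2)
      rw [Complex.norm_ofNat]; linarith
    have h3 : K = r - q := by
      linear_combination (mul_eq_zero.1 h1).resolve_left h2
    have h4 : 16 * l ^ 2 = K ^ 2 * (4 - K ^ 2) := by
      have h5 : k * m = K ^ 2 / 2 - 1 := by linear_combination -hKP / 2
      rw [h5] at hP
      linear_combination 4 * hP
    rw [← h3]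
    linear_combination h4 / 16 + (-K ^ 2 + 2 * q * K) / 16 * h
  · intro h
    set κ : ℂ := r - q with hκ
    have hκ0 : κ ^ 2 + 2 * q * κ + 4 * q ^ 2 - 4 = 0 := by
      rw [hκ]; linear_combination hrc
    have h4 : 16 * l ^ 2 = κ ^ 2 * (4 - κ ^ 2) := by
      rw [h]; linear_combination (κ ^ 2 - 2 * q * κ) * hκ0
    have hκn : ‖κ - 2‖ ≤ 1 / 50 := by
      rw [hκ, show (r : ℂ) - q - 2 = (r - 2) - q by ring]
      exact (norm_sub_le _ _).trans (by linarith)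
    -- Conversely $l^2$ fixes $(km)^2=1-4l^2$, and then $K^2=2+2km$. Both sign ambiguities disappear
    -- because $km$ is near $1$ and $K$ near $2$.
    have h5 : (k * m - (κ ^ 2 / 2 - 1)) * (k * m + (κ ^ 2 / 2 - 1)) = 0 := by
      linear_combination hP - h4 / 4
    have h6 : k * m + (κ ^ 2 / 2 - 1) ≠ 0 := by
      rw [show k * m + (κ ^ 2 / 2 - 1) = 2 + ((k * m - 1) + ((κ - 2) / 2 + 2) * (κ - 2)) by ring]
      refine add_ne_zero_of_norm_lt ((norm_add_le _ _).trans_lt ?_)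
      have h7 : ‖(κ - 2) / 2 + 2‖ ≤ 3 := (norm_add_le _ _).trans (by
        rw [norm_div, Complex.norm_ofNat]; linarith)
      rw [norm_mul, Complex.norm_ofNat]
      nlinarith [norm_nonneg (κ - 2)]
    have h9 : (K - κ) * (K + κ) = 0 := by
      have := (mul_eq_zero.1 h5).resolve_right h6
      linear_combination hKP + 2 * this
    have h10 : K + κ ≠ 0 := by
      rw [show K + κ = 4 + ((K - 2) + (κ - 2)) by ring]
      refine add_ne_zero_of_norm_lt ((norm_add_le _ _).trans_lt ?_)
      rw [Complex.norm_ofNat]; linarith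
    have h11 : K = κ := by linear_combination (mul_eq_zero.1 h9).resolve_right h10
    rw [h11]
    linear_combination hκ0

end Root

/-! ### The odd eigenfunction and its nonzero self-pairing. -/

/-- The combination of the two decaying solutions whose second component vanishes at the origin:
first component. -/
def eigA (k m : ℂ) (y x : ℝ) : ℂ :=
  jostB m y * jostA k (x + y) + jostB k y * jostA m (x + y)

/-- The derivative of `eigA`. -/
def eigA₁ (k m : ℂ) (y x : ℝ) : ℂ :=
  jostB m y * jostA₁ k (x + y) + jostB k y * jostA₁ m (x + y)

/-- The combination of the two decaying solutions that vanishes at the origin: second component. -/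
def eigB (k m : ℂ) (y x : ℝ) : ℂ :=
  jostB m y * jostB k (x + y) - jostB k y * jostB m (x + y)

/-- The derivative of `eigB`. -/
def eigB₁ (k m : ℂ) (y x : ℝ) : ℂ :=
  jostB m y * jostB₁ k (x + y) - jostB k y * jostB₁ m (x + y)

theorem inDomainC2_reflectExt {q : ℝ} {ε : ℂ} {A A₁ A₂ : ℝ → ℂ}
    (hA : ∀ x, HasDerivAt A (A₁ x) x) (hA₁ : ∀ x, HasDerivAt A₁ (A₂ x) x)
    (dA : ExpDecay A) (dA₁ : ExpDecay A₁) (dA₂ : ExpDecay A₂)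
    (h0 : ε * A 0 = A 0) (h1 : A₁ 0 + ε * A₁ 0 = -2 * q * A 0) :
    InDomainC2 q (reflectExt ε A) (reflectExt (-ε) A₁) (reflectExt ε A₂) where
  toInDomain := inDomain_reflectExt hA hA₁ dA dA₁ dA₂ h0 h1
  hasDerivAt_one x hx := by
    have := hasDerivAt_reflectExt (-ε) hA₁ hx
    rwa [neg_neg] at this

section

variable {k m l : ℂ} {y : ℝ}

theorem hasDerivAt_eigA (x : ℝ) : HasDerivAt (eigA k m y) (eigA₁ k m y x) x :=
  (((hasDerivAt_jostA k (x + y)).comp_add_const x y).const_mul _).add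
    (((hasDerivAt_jostA m (x + y)).comp_add_const x y).const_mul _)

theorem hasDerivAt_eigB (x : ℝ) : HasDerivAt (eigB k m y) (eigB₁ k m y x) x :=
  (((hasDerivAt_jostB k (x + y)).comp_add_const x y).const_mul _).sub
    (((hasDerivAt_jostB m (x + y)).comp_add_const x y).const_mul _)

theorem hasDerivAt_eigA₁ (hkl : k ^ 2 = 1 - 2 * l) (hml : m ^ 2 = 1 + 2 * l) (x : ℝ) :
    HasDerivAt (eigA₁ k m y)
      ((1 - 6 * (1 - th (x + y) ^ 2)) * eigA k m y x - 2 * l * eigB k m y x) x := by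
  refine ((((hasDerivAt_jostA₁ k (x + y)).comp_add_const x y).const_mul _).add
    (((hasDerivAt_jostA₁ m (x + y)).comp_add_const x y).const_mul _)).congr_deriv ?_
  rw [hkl, hml, eigA, eigB]
  ring

theorem hasDerivAt_eigB₁ (hkl : k ^ 2 = 1 - 2 * l) (hml : m ^ 2 = 1 + 2 * l) (x : ℝ) :
    HasDerivAt (eigB₁ k m y)
      ((1 - 2 * (1 - th (x + y) ^ 2)) * eigB k m y x - 2 * l * eigA k m y x) x := by
  refine ((((hasDerivAt_jostB₁ k (x + y)).comp_add_const x y).const_mul _).sub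
    (((hasDerivAt_jostB₁ m (x + y)).comp_add_const x y).const_mul _)).congr_deriv ?_
  rw [hkl, hml, eigA, eigB]
  ring

theorem expDecay_eigA (hk : 1 / 2 ≤ k.re) (hm : 1 / 2 ≤ m.re) : ExpDecay (eigA k m y) :=
  (((expDecay_jostA hk).comp_add y).const_mul _).add (((expDecay_jostA hm).comp_add y).const_mul _)

theorem expDecay_eigA₁ (hk : 1 / 2 ≤ k.re) (hm : 1 / 2 ≤ m.re) : ExpDecay (eigA₁ k m y) :=
  (((expDecay_jostA₁ hk).comp_add y).const_mul _).add
    (((expDecay_jostA₁ hm).comp_add y).const_mul _)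

theorem ExpDecay.sub {A B : ℝ → ℂ} (hA : ExpDecay A) (hB : ExpDecay B) :
    ExpDecay fun x => A x - B x :=
  ⟨hA.continuous.sub hB.continuous, hA.isBigO.sub hB.isBigO⟩

theorem expDecay_eigB (hk : 1 / 2 ≤ k.re) (hm : 1 / 2 ≤ m.re) : ExpDecay (eigB k m y) :=
  (((expDecay_jostB hk).comp_add y).const_mul _).sub (((expDecay_jostB hm).comp_add y).const_mul _)

theorem expDecay_eigB₁ (hk : 1 / 2 ≤ k.re) (hm : 1 / 2 ≤ m.re) : ExpDecay (eigB₁ k m y) :=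
  (((expDecay_jostB₁ hk).comp_add y).const_mul _).sub
    (((expDecay_jostB₁ hm).comp_add y).const_mul _)

theorem ExpDecay.potential_mul {A : ℝ → ℂ} (hA : ExpDecay A) (c : ℂ) (y : ℝ) :
    ExpDecay fun x => (1 - c * (1 - th (x + y) ^ 2)) * A x := by
  have hT : Continuous fun x : ℝ => th (x + y) := continuous_th.comp (continuous_add_const y)
  refine hA.bdd_mul (C := 1 + ‖c‖ * 2) (by fun_prop) fun x => ?_
  refine (norm_sub_le _ _).trans ?_
  rw [norm_one, norm_mul]
  gcongr
  refine (norm_sub_le _ _).trans ?_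
  rw [norm_one, norm_pow]
  linarith [pow_le_one₀ (n := 2) (norm_nonneg _) (norm_th_le (x + y))]

/-- The second component vanishes at the origin by construction, and `hdet` says the same of the
first. For odd extensions this is all the domain asks, since the jump condition is then trivial. -/
theorem fRep_eig {q : ℝ} (hkl : k ^ 2 = 1 - 2 * l) (hml : m ^ 2 = 1 + 2 * l)
    (hk : 1 / 2 ≤ k.re) (hm : 1 / 2 ≤ m.re)
    (hdet : jostA k (Real.artanh q) * jostB m (Real.artanh q) +
      jostA m (Real.artanh q) * jostB k (Real.artanh q) = 0) :
    FRep q (Complex.I * l) 0 0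
      (reflectExt (-1) (eigA k m (Real.artanh q))) (reflectExt (-(-1)) (eigA₁ k m (Real.artanh q)))
      (reflectExt (-1) (fun x => Complex.I * eigB k m (Real.artanh q) x))
      (reflectExt (-(-1)) (fun x => Complex.I * eigB₁ k m (Real.artanh q) x)) where
  fst := by
    have h0 : eigA k m (Real.artanh q) 0 = 0 := by
      rw [eigA, zero_add]; linear_combination hdet
    have h := inDomainC2_reflectExt (q := q) (ε := -1) hasDerivAt_eigA
      (hasDerivAt_eigA₁ (y := Real.artanh q) hkl hml) (expDecay_eigA hk hm) (expDecay_eigA₁ hk hm)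
      (((expDecay_eigA hk hm).potential_mul 6 _).sub ((expDecay_eigB hk hm).const_mul _))
      (by rw [h0]; ring) (by rw [h0]; ring)
    convert h using 1
    ext x
    rcases lt_or_ge x 0 with hx | hx
    · simp only [reflectExt_of_neg hx, abs_of_neg hx, Pi.zero_apply]
      linear_combination -2 * l * eigB k m (Real.artanh q) (-x) * Complex.I_sq
    · simp only [reflectExt_of_nonneg hx, abs_of_nonneg hx, Pi.zero_apply]
      linear_combination 2 * l * eigB k m (Real.artanh q) x * Complex.I_sq
  snd := by
    have h0 : eigB k m (Real.artanh q) 0 = 0 := by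
      rw [eigB, zero_add]; ring
    have h := inDomainC2_reflectExt (q := q) (ε := -1)
      (fun x => (hasDerivAt_eigB x).const_mul Complex.I)
      (fun x => (hasDerivAt_eigB₁ (y := Real.artanh q) hkl hml x).const_mul Complex.I)
      ((expDecay_eigB hk hm).const_mul _) ((expDecay_eigB₁ hk hm).const_mul _)
      ((((expDecay_eigB hk hm).potential_mul 2 _).sub
        ((expDecay_eigA hk hm).const_mul _)).const_mul _)
      (by rw [h0]; ring) (by rw [h0]; ring)
    convert h using 1
    ext x
    rcases lt_or_ge x 0 with hx | hx
    · simp only [reflectExt_of_neg hx, abs_of_neg hx, Pi.zero_apply]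
      ring
    · simp only [reflectExt_of_nonneg hx, abs_of_nonneg hx, Pi.zero_apply]
      ring

theorem jostB_ne_zero {q : ℝ} (hq : |q| < 1 / 100) (hk : ‖k - 1‖ ≤ 1 / 8) :
    jostB k (Real.artanh q) ≠ 0 := by
  rw [jostB, th_artanh (hq.trans (by norm_num))]
  refine mul_ne_zero ?_ (Complex.exp_ne_zero _)
  rw [show k ^ 2 + 1 + 2 * k * q = 2 + ((k - 1) * (k - 1) + 2 * (k - 1) +
    2 * ((k - 1) * q + q)) by ring]
  have hqn : ‖(q : ℂ)‖ < 1 / 100 := by simpa using hq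
  have h0 := norm_nonneg (k - 1)
  refine add_ne_zero_of_norm_lt ((norm_add_le _ _).trans_lt ?_)
  have h1 := norm_add_le ((k - 1) * (k - 1)) (2 * (k - 1))
  have h2 := norm_add_le ((k - 1) * q) (q : ℂ)
  simp only [norm_mul, Complex.norm_ofNat] at *
  nlinarith [norm_nonneg (q : ℂ)]

/-- `(∂ + tanh) eigB / (2 l)`. -/
def eigG (k m : ℂ) (y x : ℝ) : ℂ :=
  jostB m y * ((k + th (x + y)) * Complex.exp (-(k * (x + y : ℝ)))) +
    jostB k y * ((m + th (x + y)) * Complex.exp (-(m * (x + y : ℝ))))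

theorem eigB₁_add_mul (hkl : k ^ 2 = 1 - 2 * l) (hml : m ^ 2 = 1 + 2 * l) (x : ℝ) :
    eigB₁ k m y x + th (x + y) * eigB k m y x = 2 * l * eigG k m y x := by
  have h1 := jostB₁_add_mul k (x + y)
  have h2 := jostB₁_add_mul m (x + y)
  rw [hkl] at h1
  rw [hml] at h2
  rw [eigB₁, eigB, eigG]
  linear_combination jostB m y * h1 - jostB k y * h2

theorem expDecay_eigG (hk : 1 / 2 ≤ k.re) (hm : 1 / 2 ≤ m.re) : ExpDecay (eigG k m y) := by
  have h : ∀ {k : ℂ}, 1 / 2 ≤ k.re →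
      ExpDecay fun x => (k + th (x + y)) * Complex.exp (-(k * (x + y : ℝ))) := fun {k} hk => by
    have := ((expDecay_exp hk).poly_th_mul k 1 0 0).comp_add y
    simpa using this
  exact ((h hk).const_mul _).add ((h hm).const_mul _)

/-- With $S=\partial+\tanh$, $2lA=2L_-B=S^*SB$ and $SB=2lG$. Integrating $2lAB$ by parts gives
$4l^2\int G^2$; the boundary term $B\cdot SB$ vanishes at $0$ because $B(0)=0$, and at infinity by
decay. -/
theorem integral_eigA_mul_eigB (hkl : k ^ 2 = 1 - 2 * l) (hml : m ^ 2 = 1 + 2 * l) (hl : l ≠ 0)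
    (hk : 1 / 2 ≤ k.re) (hm : 1 / 2 ≤ m.re) :
    ∫ x in Set.Ioi 0, eigA k m y x * eigB k m y x = 2 * l * ∫ x in Set.Ioi 0, eigG k m y x ^ 2 := by
  have dA := expDecay_eigA (y := y) hk hm
  have dB := expDecay_eigB (y := y) hk hm
  have dG := expDecay_eigG (y := y) hk hm
  have i1 : IntegrableOn (fun x => eigA k m y x * eigB k m y x) (Set.Ioi 0) :=
    dA.memLp.integrable_mul dB.memLp
  have i2 : IntegrableOn (fun x => eigG k m y x ^ 2) (Set.Ioi 0) := by
    simp only [pow_two]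
    exact dG.memLp.integrable_mul dG.memLp
  have hd : ∀ x ∈ Set.Ici (0 : ℝ),
      HasDerivAt (fun x => eigB k m y x * (eigB₁ k m y x + th (x + y) * eigB k m y x))
      (4 * l ^ 2 * eigG k m y x ^ 2 - 2 * l * (eigA k m y x * eigB k m y x)) x := fun x _ => by
    refine ((hasDerivAt_eigB x).mul ((hasDerivAt_eigB₁ hkl hml x).add
      (((hasDerivAt_th (x + y)).comp_add_const x y).mul (hasDerivAt_eigB x)))).congr_deriv ?_
    have := eigB₁_add_mul (y := y) hkl hml x
    simp only [Pi.add_apply, Pi.mul_apply]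
    linear_combination (eigB₁ k m y x + th (x + y) * eigB k m y x + 2 * l * eigG k m y x) * this
  have ht : Tendsto (fun x => eigB k m y x * (eigB₁ k m y x + th (x + y) * eigB k m y x)) atTop
      (𝓝 0) := by
    have : Tendsto (fun x => eigB k m y x * (2 * l * eigG k m y x)) atTop (𝓝 0) := by
      simpa using dB.tendsto.mul (dG.tendsto.const_mul (2 * l))
    refine this.congr fun x => ?_
    rw [eigB₁_add_mul hkl hml]
  have key := integral_Ioi_of_hasDerivAt_of_tendsto' hd
    ((i2.const_mul _).sub (i1.const_mul _)) ht
  have h0 : eigB k m y 0 = 0 := by rw [eigB, zero_add]; ring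
  rw [integral_sub (i2.const_mul _) (i1.const_mul _), integral_const_mul, integral_const_mul, h0,
    zero_mul, sub_zero] at key
  refine mul_left_cancel₀ (mul_ne_zero two_ne_zero hl) ?_
  linear_combination -key

theorem eigG_zero_ne_zero {q : ℝ} (hq : |q| < 1 / 100) (hk : ‖k - 1‖ ≤ 1 / 8)
    (hm : ‖m - 1‖ ≤ 1 / 8) (h : k ^ 2 + m ^ 2 = 2) : eigG k m (Real.artanh q) 0 ≠ 0 := by
  have e : eigG k m (Real.artanh q) 0 = (k + m) / 2 * (k + m + 2 * q) ^ 2 *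
      (Complex.exp (-(k * Real.artanh q)) * Complex.exp (-(m * Real.artanh q))) := by
    rw [eigG, jostB, jostB, zero_add, th_artanh (hq.trans (by norm_num))]
    linear_combination (-((k + m) / 2 + q)) *
      (Complex.exp (-(k * Real.artanh q)) * Complex.exp (-(m * Real.artanh q))) * h
  have hqn : ‖(q : ℂ)‖ < 1 / 100 := by simpa using hq
  rw [e]
  refine mul_ne_zero (mul_ne_zero (div_ne_zero ?_ two_ne_zero) (pow_ne_zero 2 ?_))
    (mul_ne_zero (Complex.exp_ne_zero _) (Complex.exp_ne_zero _))
  · rw [show k + m = 2 + ((k - 1) + (m - 1)) by ring]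
    refine add_ne_zero_of_norm_lt ((norm_add_le _ _).trans_lt ?_)
    rw [Complex.norm_ofNat]; linarith
  · rw [show k + m + 2 * (q : ℂ) = 2 + ((k - 1) + (m - 1) + 2 * q) by ring]
    refine add_ne_zero_of_norm_lt ((norm_add₃_le).trans_lt ?_)
    rw [norm_mul, Complex.norm_ofNat]; linarith

theorem conj_two : (starRingEnd ℂ) 2 = 2 := map_ofNat _ 2

open ComplexConjugate in
-- `eigG` is symmetric under exchange of $k$ and $m$ and has real coefficients otherwise, so it is
-- real whenever conjugation permutes the two exponents.
theorem conj_eigG (h : (conj k = k ∧ conj m = m) ∨ (conj k = m ∧ conj m = k)) (x : ℝ) :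
    conj (eigG k m y x) = eigG k m y x := by
  have hT : ∀ x, conj (th x) = th x := fun x => Complex.conj_ofReal _
  have hB : ∀ k y, conj (jostB k y) = jostB (conj k) y := fun k y => by
    simp [jostB, hT, ← Complex.exp_conj, conj_two]
  rw [eigG]
  simp only [map_add, map_mul, hB, hT, ← Complex.exp_conj, map_neg, Complex.conj_ofReal]
  rcases h with ⟨h1, h2⟩ | ⟨h1, h2⟩
  · rw [h1, h2]
  · rw [h1, h2, add_comm]

open ComplexConjugate in
-- As $l^2$ is real, $\bar l=\pm l$: the plus sign fixes $k^2$ and $m^2$ under conjugation, the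
-- minus sign swaps them. Positive real parts carry this over to $k$ and $m$.
theorem conj_exponents {s : ℝ} (hl : l ^ 2 = s) (hkl : k ^ 2 = 1 - 2 * l)
    (hml : m ^ 2 = 1 + 2 * l) (hk : 1 / 2 ≤ k.re) (hm : 1 / 2 ≤ m.re) :
    (conj k = k ∧ conj m = m) ∨ (conj k = m ∧ conj m = k) := by
  have key : ∀ a b : ℂ, 1 / 2 ≤ a.re → 1 / 2 ≤ b.re → conj (a ^ 2) = b ^ 2 → conj a = b := by
    intro a b ha hb h
    rw [map_pow] at h
    rcases sq_eq_sq_iff_eq_or_eq_neg.1 h with h | h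
    · exact h
    · have := congrArg Complex.re h
      simp at this
      linarith
  have h1 : (conj l) ^ 2 = l ^ 2 := by rw [← map_pow, hl, Complex.conj_ofReal]
  rcases sq_eq_sq_iff_eq_or_eq_neg.1 h1 with h | h
  · left
    exact ⟨key _ _ hk hk (by rw [hkl]; simp [h, conj_two]), key _ _ hm hm (by rw [hml]; simp [h, conj_two])⟩
  · right
    refine ⟨key _ _ hk hm ?_, key _ _ hm hk ?_⟩
    · rw [hkl, hml]; simp [h, conj_two]
    · rw [hkl, hml]; simp [h, sub_eq_add_neg, conj_two]

theorem integral_eigG_sq_ne_zero (hk : 1 / 2 ≤ k.re) (hm : 1 / 2 ≤ m.re)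
    (hc : ∀ x, (starRingEnd ℂ) (eigG k m y x) = eigG k m y x) (h0 : eigG k m y 0 ≠ 0) :
    ∫ x in Set.Ioi 0, eigG k m y x ^ 2 ≠ 0 := by
  have dG := expDecay_eigG (y := y) hk hm
  have hre : ∀ x, eigG k m y x = ((eigG k m y x).re : ℂ) := fun x =>
    (Complex.conj_eq_iff_re.1 (hc x)).symm
  have e : ∀ x, eigG k m y x ^ 2 = (((eigG k m y x).re ^ 2 : ℝ) : ℂ) := fun x => by
    rw [Complex.ofReal_pow, ← hre]
  simp_rw [e]
  rw [integral_complex_ofReal, Complex.ofReal_ne_zero]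
  have hcont : Continuous fun x => (eigG k m y x).re ^ 2 :=
    (Complex.continuous_re.comp dG.continuous).pow 2
  have hint : IntegrableOn (fun x => (eigG k m y x).re ^ 2) (Set.Ioi 0) := by
    have : IntegrableOn (fun x => eigG k m y x ^ 2) (Set.Ioi 0) := by
      simp only [pow_two]
      exact dG.memLp.integrable_mul dG.memLp
    simp_rw [e] at this
    exact this.re
  intro hz
  rw [setIntegral_eq_zero_iff_of_nonneg_ae (Eventually.of_forall fun x => sq_nonneg _) hint] at hz
  have hz' : Set.EqOn (fun x => (eigG k m y x).re ^ 2) 0 (Set.Ioi 0) :=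
    Measure.eqOn_of_ae_eq hz hcont.continuousOn continuousOn_const
      (by rw [interior_Ioi]; exact subset_closure)
  have h1 : (eigG k m y 0).re ^ 2 = 0 := by
    refine tendsto_nhds_unique ((hcont.tendsto 0).mono_left nhdsWithin_le_nhds)
      (tendsto_const_nhds.congr' (f₁ := fun _ => (0 : ℝ)) (l₁ := 𝓝[>] 0) ?_)
    filter_upwards [self_mem_nhdsWithin] with x hx using (hz' hx).symm
  apply h0
  rw [hre, pow_eq_zero_iff two_ne_zero |>.1 h1, Complex.ofReal_zero]

theorem integral_comp_abs_complex {f : ℝ → ℂ} (hf : IntegrableOn f (Set.Ioi 0)) :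
    ∫ x, f |x| = 2 * ∫ x in Set.Ioi 0, f x := by
  have h1 : IntegrableOn (fun x => f |x|) (Set.Ioi 0) :=
    hf.congr_fun (fun x hx => by rw [abs_of_pos hx]) measurableSet_Ioi
  have h2 : IntegrableOn (fun x => f |x|) (Set.Iic 0) := by
    rw [← integrableOn_Ici_iff_integrableOn_Ioi] at h1
    have := (Measure.measurePreserving_neg (volume : Measure ℝ)).integrableOn_comp_preimage
      (Homeomorph.neg ℝ).measurableEmbedding (f := fun x => f |x|) (s := Set.Ici 0)
    have h3 := this.2 h1
    simpa [Function.comp_def] using h3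
  rw [← intervalIntegral.integral_Iic_add_Ioi h2 h1, two_mul]
  congr 1
  · have := integral_comp_neg_Iic 0 f
    rw [neg_zero] at this
    rw [← this]
    exact setIntegral_congr_fun measurableSet_Iic fun x hx => by rw [abs_of_nonpos hx]
  · exact setIntegral_congr_fun measurableSet_Ioi fun x hx => by rw [abs_of_pos hx]

/-- The product of two odd functions is even, so the integral is $2i\cdot2l\int_0^\infty G^2$, and
$G$ is real with $G(0)\ne0$. This nonvanishing is what excludes Jordan blocks. -/
theorem integral_eig_ne_zero {q : ℝ} (hq : |q| < 1 / 100) {s : ℝ} (hs : l ^ 2 = s) (hl : l ≠ 0)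
    (hkl : k ^ 2 = 1 - 2 * l) (hml : m ^ 2 = 1 + 2 * l)
    (hk : ‖k - 1‖ ≤ 1 / 8) (hm : ‖m - 1‖ ≤ 1 / 8) :
    ∫ x, reflectExt (-1) (eigA k m (Real.artanh q)) x *
      reflectExt (-1) (fun x => Complex.I * eigB k m (Real.artanh q) x) x ≠ 0 := by
  have hk' := half_le_re hk
  have hm' := half_le_re hm
  have e : ∀ x, reflectExt (-1) (eigA k m (Real.artanh q)) x *
      reflectExt (-1) (fun x => Complex.I * eigB k m (Real.artanh q) x) x =
      (fun x => Complex.I * (eigA k m (Real.artanh q) x * eigB k m (Real.artanh q) x)) |x| := by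
    intro x
    rcases lt_or_ge x 0 with hx | hx
    · simp only [reflectExt_of_neg hx, abs_of_neg hx]; ring
    · simp only [reflectExt_of_nonneg hx, abs_of_nonneg hx]; ring
  have hint : IntegrableOn (fun x => Complex.I * (eigA k m (Real.artanh q) x *
      eigB k m (Real.artanh q) x)) (Set.Ioi 0) :=
    ((expDecay_eigA hk' hm').memLp.integrable_mul (expDecay_eigB hk' hm').memLp).const_mul _
  rw [(integral_congr_ae (Eventually.of_forall e)).trans (integral_comp_abs_complex hint),
    integral_const_mul, integral_eigA_mul_eigB hkl hml hl hk' hm']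
  refine mul_ne_zero two_ne_zero (mul_ne_zero Complex.I_ne_zero
    (mul_ne_zero (mul_ne_zero two_ne_zero hl) ?_))
  exact integral_eigG_sq_ne_zero hk' hm' (conj_eigG (conj_exponents hs hkl hml hk' hm'))
    (eigG_zero_ne_zero hq hk hm (by rw [hkl, hml]; ring))

end

/-! ### Generalized eigenspaces, absence of other eigenvalues, simplicity and the symmetry
$\sigma_3$. -/

section Spectral

variable {E : Type*} [AddCommGroup E] [Module ℂ E] {T : E →ₗ.[ℂ] E} {z : ℂ}

/-- Induction on the power: to bound every $\ker(T-z)^n$, it suffices that $S$ contains all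
preimages of its elements under $T-z$. -/
theorem genEigenspace_le {S : Submodule ℂ E}
    (h : ∀ (u : E) (hu : u ∈ T.domain), T ⟨u, hu⟩ - z • u ∈ S → u ∈ S) :
    genEigenspace T z ≤ S := by
  refine iSup_le fun n => ?_
  induction n with
  | zero => exact bot_le
  | succ n ih =>
    intro u hu
    obtain ⟨hd, hu⟩ := (mem_kerPow_succ T z n u).1 hu
    exact h u hd (ih hu)

theorem mem_genEigenspace_of_mem_kerPow {n : ℕ} {u : E} (h : u ∈ kerPow T z n) :
    u ∈ genEigenspace T z := (le_iSup (kerPow T z) n) h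

theorem mem_kerPow_one {u : E} (h : ∃ h : u ∈ T.domain, T ⟨u, h⟩ = z • u) :
    u ∈ kerPow T z 1 := by
  obtain ⟨hd, h⟩ := h
  exact (mem_kerPow_succ T z 0 u).2 ⟨hd, by rw [h, sub_self]; exact zero_mem _⟩

end Spectral

theorem eq_mul_reflectExt {f A : ℝ → ℂ} {t ε : ℂ}
    (h : ∀ x > 0, f x = t * A x ∧ f (-x) = t * (ε * A x)) :
    ∀ x ≠ 0, f x = t * reflectExt ε A x := by
  intro x hx
  rcases hx.lt_or_gt with hx | hx
  · rw [reflectExt_of_neg hx, ← (h (-x) (neg_pos.2 hx)).2, neg_neg]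
  · rw [reflectExt_of_nonneg hx.le, (h x hx).1]

theorem Lp_eq_smul {u w : L2} {f g : ℝ → ℂ} {t : ℂ} (hu : u =ᵐ[volume] f) (hw : w =ᵐ[volume] g)
    (h : ∀ x ≠ 0, f x = t * g x) : u = t • w := by
  refine Lp.ext ?_
  filter_upwards [hu, hw, ae_ne_zero, Lp.coeFn_smul t w] with x h1 h2 h3 h4
  rw [h1, h4, Pi.smul_apply, h2, smul_eq_mul, h x h3]

section

variable {q : ℝ} {l k m : ℂ}

/-- In the variables $X=e(k+q)e^{-ky}$ and $Y=d(m+q)e^{-my}$ the conditions read $2l(X+Y)=0$ and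
$(2-2q^2)(X+Y)+2l(X-Y)=0$, so both vanish when $l\ne0$. -/
theorem even_coeff_eq_zero (hq : |q| < 1 / 100) (hl : l ≠ 0)
    (hkl : k ^ 2 = 1 - 2 * l) (hml : m ^ 2 = 1 + 2 * l)
    (hk : ‖k - 1‖ ≤ 1 / 8) (hm : ‖m - 1‖ ≤ 1 / 8) {e d : ℂ}
    (h1 : e * (jostA₁ k (Real.artanh q) + q * jostA k (Real.artanh q)) +
        d * (jostA₁ m (Real.artanh q) + q * jostA m (Real.artanh q)) = 0)
    (h2 : e * (jostB₁ k (Real.artanh q) + q * jostB k (Real.artanh q)) -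
        d * (jostB₁ m (Real.artanh q) + q * jostB m (Real.artanh q)) = 0) : e = 0 ∧ d = 0 := by
  have eA := fun k => jostA₁_add_mul k (Real.artanh q)
  have eB := fun k => jostB₁_add_mul k (Real.artanh q)
  simp only [th_artanh (hq.trans (by norm_num : (1 / 100 : ℝ) < 1))] at eA eB
  rw [eA, eA, hkl, hml] at h1
  rw [eB, eB, hkl, hml] at h2
  have hne : ∀ k : ℂ, ‖k - 1‖ ≤ 1 / 8 → (k + q) * Complex.exp (-(k * Real.artanh q)) ≠ 0 := by
    intro k hk
    have hqn : ‖(q : ℂ)‖ < 1 / 100 := by simpa using hq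
    refine mul_ne_zero ?_ (Complex.exp_ne_zero _)
    rw [show k + q = 1 + ((k - 1) + q) by ring]
    refine add_ne_zero_of_norm_lt ((norm_add_le _ _).trans_lt ?_)
    rw [norm_one]; linarith
  set X := e * ((k + q) * Complex.exp (-(k * Real.artanh q))) with hX
  set Y := d * ((m + q) * Complex.exp (-(m * Real.artanh q))) with hY
  have s1 : X + Y = 0 := by
    refine mul_left_cancel₀ (mul_ne_zero two_ne_zero hl) ?_
    rw [hX, hY]
    linear_combination h2
  have s2 : X - Y = 0 := by
    refine mul_left_cancel₀ (mul_ne_zero two_ne_zero hl) ?_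
    rw [hX, hY] at *
    linear_combination h1 - (2 - 2 * (q : ℂ) ^ 2) * s1
  have hX0 : X = 0 := by linear_combination (s1 + s2) / 2
  have hY0 : Y = 0 := by linear_combination (s1 - s2) / 2
  exact ⟨(mul_eq_zero.1 hX0).resolve_right (hne k hk), (mul_eq_zero.1 hY0).resolve_right (hne m hm)⟩

theorem exists_exponents (hl : ‖l‖ ≤ 1 / 16) : ∃ k m : ℂ, k ^ 2 = 1 - 2 * l ∧
    m ^ 2 = 1 + 2 * l ∧ ‖k - 1‖ ≤ 1 / 8 ∧ ‖m - 1‖ ≤ 1 / 8 := by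
  obtain ⟨k, hk, hk'⟩ := exists_sq_eq_one_add (-(2 * l))
  obtain ⟨m, hm, hm'⟩ := exists_sq_eq_one_add (2 * l)
  rw [norm_neg] at hk'
  rw [norm_mul, Complex.norm_ofNat] at hk' hm'
  exact ⟨k, m, by rw [hk]; ring, hm, by linarith, by linarith⟩

theorem exists_fRep_eigen {z : ℂ} {u : L2 × L2}
    (h : ∃ h : u ∈ (F q).domain, F q ⟨u, h⟩ - z • u = 0) :
    ∃ f f₁ g g₁, u.1 =ᵐ[volume] f ∧ u.2 =ᵐ[volume] g ∧ FRep q z 0 0 f f₁ g g₁ :=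
  exists_fRep h (Lp.coeFn_zero _ _ _) (Lp.coeFn_zero _ _ _) (fun _ _ => continuousAt_const)
    fun _ _ => continuousAt_const

/-- Away from the roots of the determinant there are no eigenfunctions. -/
theorem eq_zero_of_eigen (hq : |q| < 1 / 100) (hl : l ≠ 0) (hln : ‖l‖ ≤ 1 / 16)
    (hs : l ^ 2 ≠ eigSq q) {u : L2 × L2}
    (h : ∃ h : u ∈ (F q).domain, F q ⟨u, h⟩ - (Complex.I * l) • u = 0) : u = 0 := by
  obtain ⟨k, m, hkl, hml, hk, hm⟩ := exists_exponents hln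
  obtain ⟨f, f₁, g, g₁, huf, hug, H⟩ := exists_fRep_eigen h
  obtain ⟨e, d, o, p, h1, h2, h3, h4, h5⟩ :=
    H.exists_coeff hkl hml hk hm (hq.trans (by norm_num))
  obtain ⟨rfl, rfl⟩ := even_coeff_eq_zero hq hl hkl hml hk hm h1 h2
  have hdet := mt (jost_det_eq_zero_iff hq hkl hml hk hm).1 hs
  have ho : o = 0 := by
    refine mul_right_cancel₀ hdet ?_
    linear_combination jostB m (Real.artanh q) * h3 + jostA m (Real.artanh q) * h4
  have hp : p = 0 := by
    refine mul_right_cancel₀ hdet ?_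
    linear_combination jostB k (Real.artanh q) * h3 - jostA k (Real.artanh q) * h4
  subst ho hp
  have z1 : ∀ x > 0, f x = 0 * (0 : ℝ → ℂ) x ∧ f (-x) = 0 * (1 * (0 : ℝ → ℂ) x) := fun x hx => by
    obtain ⟨a, b, -, -⟩ := h5 x hx
    rw [a, b]; constructor <;> ring
  have z2 : ∀ x > 0, g x = 0 * (0 : ℝ → ℂ) x ∧ g (-x) = 0 * (1 * (0 : ℝ → ℂ) x) := fun x hx => by
    obtain ⟨-, -, a, b⟩ := h5 x hx
    rw [a, b]; constructor <;> ring
  refine Prod.ext ?_ ?_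
  · refine (Lp_eq_smul (w := 0) (g := f) (t := 0) huf ?_ ?_).trans (smul_zero _)
    · filter_upwards [ae_ne_zero, Lp.coeFn_zero ℂ 2 (volume : Measure ℝ)] with x hx h0
      rw [h0, eq_mul_reflectExt z1 x hx, zero_mul, Pi.zero_apply]
    · intro x hx
      rw [eq_mul_reflectExt z1 x hx, zero_mul, zero_mul]
  · refine (Lp_eq_smul (w := 0) (g := g) (t := 0) hug ?_ ?_).trans (smul_zero _)
    · filter_upwards [ae_ne_zero, Lp.coeFn_zero ℂ 2 (volume : Measure ℝ)] with x hx h0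
      rw [h0, eq_mul_reflectExt z2 x hx, zero_mul, Pi.zero_apply]
    · intro x hx
      rw [eq_mul_reflectExt z2 x hx, zero_mul, zero_mul]

theorem reflectExt_neg_one_neg {A : ℝ → ℂ} {x : ℝ} (hx : x ≠ 0) :
    reflectExt (-1) A (-x) = -reflectExt (-1) A x := by
  rcases hx.lt_or_gt with h | h
  · rw [reflectExt_of_neg h, reflectExt_of_nonneg (by linarith)]; ring
  · rw [reflectExt_of_nonneg h.le, reflectExt_of_neg (by linarith), neg_neg]; ring

theorem ae_odd {u : L2} {A : ℝ → ℂ} (hu : u =ᵐ[volume] reflectExt (-1) A) :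
    ∀ᵐ x : ℝ, u (-x) = -u x := by
  have h := (Measure.measurePreserving_neg (volume : Measure ℝ)).quasiMeasurePreserving.ae hu
  filter_upwards [hu, h, ae_ne_zero] with x h1 h2 h3
  rw [h2, h1, reflectExt_neg_one_neg h3]

/-- At a root of the determinant the eigenvalue is simple and the eigenfunction is odd. -/
theorem exists_odd_eigen (hq : |q| < 1 / 100) (hl : l ≠ 0) (hln : ‖l‖ ≤ 1 / 16)
    (hs : l ^ 2 = eigSq q) : ∃ w : L2 × L2, w ≠ 0 ∧ IsOdd w ∧
      (∃ h : w ∈ (F q).domain, F q ⟨w, h⟩ = (Complex.I * l) • w) ∧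
      genEigenspace (F q) (Complex.I * l) = Submodule.span ℂ {w} := by
  obtain ⟨k, m, hkl, hml, hk, hm⟩ := exists_exponents hln
  have hdet := (jost_det_eq_zero_iff hq hkl hml hk hm).2 hs
  have W := fRep_eig hkl hml (half_le_re hk) (half_le_re hm) hdet
  have hint := integral_eig_ne_zero hq hs hl hkl hml hk hm
  set a := reflectExt (-1) (eigA k m (Real.artanh q)) with ha
  set b := reflectExt (-1) (fun x => Complex.I * eigB k m (Real.artanh q) x) with hb
  set w : L2 × L2 := (W.fst.memLp.toLp a, W.snd.memLp.toLp b) with hw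
  have w1 : w.1 =ᵐ[volume] a := W.fst.memLp.coeFn_toLp
  have w2 : w.2 =ᵐ[volume] b := W.snd.memLp.coeFn_toLp
  have heig : ∃ h : w ∈ (F q).domain, F q ⟨w, h⟩ = (Complex.I * l) • w := by
    refine F_eq_of_inDomain (κ₁ := fun x => Complex.I * l * a x)
      (κ₂ := fun x => Complex.I * l * b x) w1 w2 ?_ ?_ W.fst.toInDomain W.snd.toInDomain ?_ ?_
    · filter_upwards [w1, Lp.coeFn_smul (Complex.I * l) w.1] with x e1 e2
      rw [Prod.smul_fst, e2, Pi.smul_apply, e1, smul_eq_mul]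
    · filter_upwards [w2, Lp.coeFn_smul (Complex.I * l) w.2] with x e1 e2
      rw [Prod.smul_snd, e2, Pi.smul_apply, e1, smul_eq_mul]
    · intro x _; simp only [Pi.zero_apply]; ring
    · intro x _; simp only [Pi.zero_apply]; ring
  refine ⟨w, ?_, ?_, heig, le_antisymm (genEigenspace_le ?_) ?_⟩
  · intro h0
    apply hint
    rw [h0] at w1
    refine integral_eq_zero_of_ae ?_
    filter_upwards [w1, Lp.coeFn_zero ℂ 2 (volume : Measure ℝ)] with x e1 e2
    rw [← e1, Prod.fst_zero, e2, Pi.zero_apply, zero_mul]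
  · filter_upwards [ae_odd w1, ae_odd w2] with x h1 h2 using ⟨h1, h2⟩
  · intro u hu hmem
    obtain ⟨γ, hγ⟩ := Submodule.mem_span_singleton.1 hmem
    have c : ∀ {A : ℝ → ℂ}, Continuous A → Continuous fun x => γ * A x := fun h => h.const_mul γ
    obtain ⟨f, f₁, g, g₁, huf, hug, H⟩ := exists_fRep (q := q) (z := Complex.I * l) (u := u)
      (r := γ • w) (ρ₁ := fun x => γ * a x) (ρ₂ := fun x => γ * b x) ⟨hu, hγ.symm⟩
      (by filter_upwards [w1, Lp.coeFn_smul γ w.1] with x e1 e2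
          rw [Prod.smul_fst, e2, Pi.smul_apply, e1, smul_eq_mul])
      (by filter_upwards [w2, Lp.coeFn_smul γ w.2] with x e1 e2
          rw [Prod.smul_snd, e2, Pi.smul_apply, e1, smul_eq_mul])
      (fun x _ => (c W.fst.continuous).continuousAt) (fun x _ => (c W.snd.continuous).continuousAt)
    -- The nonzero pairing forces $\gamma=0$, so $u$ is a genuine eigenvector and the matching
    -- conditions make it a multiple of $w$.
    have hγ0 : γ = 0 := (mul_eq_zero.1 (H.mul_integral_eq_zero W)).resolve_right hint
    subst hγ0
    have H' : FRep q (Complex.I * l) 0 0 f f₁ g g₁ := by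
      simp only [zero_mul] at H
      exact H
    obtain ⟨e, d, o, p, h1, h2, h3, h4, h5⟩ :=
      H'.exists_coeff hkl hml hk hm (hq.trans (by norm_num))
    obtain ⟨rfl, rfl⟩ := even_coeff_eq_zero hq hl hkl hml hk hm h1 h2
    have hBm := jostB_ne_zero hq hm
    set t := o / jostB m (Real.artanh q) with ht
    have ho : o = t * jostB m (Real.artanh q) := (div_mul_cancel₀ _ hBm).symm
    have hp : p = t * jostB k (Real.artanh q) := by
      refine mul_right_cancel₀ hBm ?_
      rw [ho] at h4
      linear_combination -h4
    refine Submodule.mem_span_singleton.2 ⟨t, (Prod.ext ?_ ?_).symm⟩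
    · refine Lp_eq_smul huf w1 (eq_mul_reflectExt fun x hx => ?_)
      obtain ⟨r1, r2, -, -⟩ := h5 x hx
      rw [r1, r2, eigA, ho, hp]
      constructor <;> ring
    · refine Lp_eq_smul hug w2 (eq_mul_reflectExt fun x hx => ?_)
      obtain ⟨-, -, r1, r2⟩ := h5 x hx
      rw [r1, r2, eigB, ho, hp]
      constructor <;> ring
  · rw [Submodule.span_singleton_le_iff_mem]
    exact mem_genEigenspace_of_mem_kerPow (mem_kerPow_one heig)

/-- $F_q$ is off-diagonal, hence anticommutes with $\sigma_3$. -/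
theorem F_sigma3 {z : ℂ} {w : L2 × L2} (h : ∃ h : w ∈ (F q).domain, F q ⟨w, h⟩ = z • w) :
    ∃ h : sigma3 w ∈ (F q).domain, F q ⟨sigma3 w, h⟩ = (-z) • sigma3 w := by
  obtain ⟨h1, h2⟩ := (F_eq_iff q w _).1 h
  refine (F_eq_iff q _ _).2 ⟨?_, ?_⟩
  · have := neg_mem h1
    simpa [sigma3] using this
  · simpa [sigma3] using h2

theorem IsOdd.sigma3 {w : L2 × L2} (h : IsOdd w) : IsOdd (sigma3 w) := by
  have hn := Lp.coeFn_neg w.2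
  have hn' := (Measure.measurePreserving_neg (volume : Measure ℝ)).quasiMeasurePreserving.ae hn
  filter_upwards [h, hn, hn'] with x h1 h2 h3
  refine ⟨h1.1, ?_⟩
  change (-w.2 : L2) (-x) = -(-w.2 : L2) x
  rw [h2, h3, Pi.neg_apply, Pi.neg_apply, h1.2]

theorem sigma3_sigma3 (w : L2 × L2) : sigma3 (sigma3 w) = w := by
  simp [sigma3]

end

/-! ### The frequency derivative of the ground state and the generalized kernel. -/

theorem hasDerivAt_artanh {x : ℝ} (hx : x ∈ Set.Ioo (-1 : ℝ) 1) :
    HasDerivAt Real.artanh (1 / (1 - x ^ 2)) x := by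
  have h1 : 0 < 1 + x := by linarith [hx.1]
  have h2 : 0 < 1 - x := by linarith [hx.2]
  have h3 : HasDerivAt (fun x : ℝ => 1 / 2 * (Real.log (1 + x) - Real.log (1 - x)))
      (1 / 2 * (1 / (1 + x) - -1 / (1 - x))) x :=
    ((((hasDerivAt_id x).const_add 1).log h1.ne').sub
      (((hasDerivAt_id x).const_sub 1).log h2.ne')).const_mul _
  refine (h3.congr_of_eventuallyEq ?_).congr_deriv ?_
  · filter_upwards [Ioo_mem_nhds hx.1 hx.2] with y hy
    rw [Real.artanh_eq_half_log ⟨hy.1.le, hy.2.le⟩,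
      Real.log_div (by linarith [hy.1]) (by linarith [hy.2])]
  · have h4 : 1 - x ^ 2 ≠ 0 := by nlinarith
    field_simp
    ring

/-- The derivative of the ground state with respect to its frequency parameter. -/
theorem hasDerivAt_groundState {q : ℝ} (hq : |q| < 1) (x : ℝ) :
    HasDerivAt (fun l => groundState q l x)
      ((Real.cosh (|x| + Real.artanh q))⁻¹ - (|x| - q / (1 - q ^ 2)) *
        (Real.tanh (|x| + Real.artanh q) * (Real.cosh (|x| + Real.artanh q))⁻¹)) 1 := by
  have h1 : HasDerivAt (fun l : ℝ => q / l) (-q) 1 := by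
    have := (hasDerivAt_inv (one_ne_zero (α := ℝ))).const_mul q
    simpa [div_eq_mul_inv] using this
  have hq' : q / 1 ∈ Set.Ioo (-1 : ℝ) 1 := by rw [div_one]; exact abs_lt.1 hq
  have h2 : HasDerivAt (fun l : ℝ => l * |x| + Real.artanh (q / l))
      (|x| - q / (1 - q ^ 2)) 1 := by
    refine (((hasDerivAt_id (1 : ℝ)).mul_const |x|).add
      ((hasDerivAt_artanh hq').comp 1 h1)).congr_deriv ?_
    rw [div_one]; ring
  have h3 := (hasDerivAt_id (1 : ℝ)).mul ((hasDerivAt_real_sech _).comp 1 h2)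
  refine (h3.congr_of_eventuallyEq (Eventually.of_forall fun l => ?_)).congr_deriv ?_
  · simp [groundState, div_eq_mul_inv]
  · simp only [one_mul, div_one, Function.comp, id]
    ring

/-- The `l`-derivative of the ground state on the half line. -/
def genKer (y c x : ℝ) : ℂ := sech (x + y) - (x - c) * (th (x + y) * sech (x + y))

/-- The derivative of `genKer`. -/
def genKer₁ (y c x : ℝ) : ℂ :=
  -2 * (th (x + y) * sech (x + y)) - (x - c) * (sech (x + y) * (1 - 2 * th (x + y) ^ 2))

section

variable (y c : ℝ)

theorem hasDerivAt_th_add (x : ℝ) : HasDerivAt (fun x => th (x + y)) (1 - th (x + y) ^ 2) x :=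
  (hasDerivAt_th (x + y)).comp_add_const x y

theorem hasDerivAt_sech_add (x : ℝ) :
    HasDerivAt (fun x => sech (x + y)) (-(th (x + y) * sech (x + y))) x :=
  (hasDerivAt_sech (x + y)).comp_add_const x y

theorem hasDerivAt_ofReal_sub (x : ℝ) : HasDerivAt (fun x : ℝ => (x : ℂ) - c) 1 x :=
  (HasDerivAt.ofReal_comp (hasDerivAt_id x)).sub_const _ |>.congr_deriv (by simp)

theorem hasDerivAt_genKer (x : ℝ) : HasDerivAt (genKer y c) (genKer₁ y c x) x := by
  refine ((hasDerivAt_sech_add y x).sub ((hasDerivAt_ofReal_sub c x).mul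
    ((hasDerivAt_th_add y x).mul (hasDerivAt_sech_add y x)))).congr_deriv ?_
  simp only [Pi.mul_apply, genKer₁]
  ring

theorem hasDerivAt_genKer₁ (x : ℝ) : HasDerivAt (genKer₁ y c)
    ((1 - 6 * (1 - th (x + y) ^ 2)) * genKer y c x + 2 * sech (x + y)) x := by
  refine ((((hasDerivAt_th_add y x).mul (hasDerivAt_sech_add y x)).const_mul (-2)).sub
    ((hasDerivAt_ofReal_sub c x).mul ((hasDerivAt_sech_add y x).mul
    ((((hasDerivAt_th_add y x).pow 2).const_mul 2).const_sub 1)))).congr_deriv ?_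
  simp only [Pi.mul_apply, Pi.pow_apply, genKer]
  push_cast
  ring

theorem hasDerivAt_neg_th_mul_sech (x : ℝ) :
    HasDerivAt (fun x => -(th (x + y) * sech (x + y)))
      ((1 - 2 * (1 - th (x + y) ^ 2)) * sech (x + y)) x := by
  refine ((hasDerivAt_th_add y x).mul (hasDerivAt_sech_add y x)).neg.congr_deriv ?_
  ring

theorem expDecay_sech_add : ExpDecay fun x => sech (x + y) := expDecay_sech.comp_add y

theorem expDecay_neg_th_mul_sech : ExpDecay fun x => -(th (x + y) * sech (x + y)) := by
  have := (expDecay_sech.poly_th_mul 0 (-1) 0 0).comp_add y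
  convert this using 2
  ring

theorem expDecay_genKer : ExpDecay (genKer y c) := by
  -- Writing $x-c=(x+y)-(y+c)$ makes every term a function of $x+y$.
  have h1 := (expDecay_sech.poly_th_mul 1 (y + c) 0 0).comp_add y
  have h2 := (expDecay_id_mul_sech.poly_th_mul 0 (-1) 0 0).comp_add y
  convert h1.add h2 using 2 with x
  rw [genKer]
  push_cast
  ring

theorem expDecay_genKer₁ : ExpDecay (genKer₁ y c) := by
  have h1 := (expDecay_sech.poly_th_mul (y + c) (-2) (-2 * (y + c)) 0).comp_add y
  have h2 := (expDecay_id_mul_sech.poly_th_mul (-1) 0 2 0).comp_add y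
  convert h1.add h2 using 2 with x
  rw [genKer₁]
  push_cast
  ring

end

section

variable {q : ℝ}

theorem inDomainC2_sech (hq : |q| < 1) :
    InDomainC2 q (reflectExt 1 fun x => sech (x + Real.artanh q))
      (reflectExt (-1) fun x => -(th (x + Real.artanh q) * sech (x + Real.artanh q)))
      (reflectExt 1 fun x =>
        (1 - 2 * (1 - th (x + Real.artanh q) ^ 2)) * sech (x + Real.artanh q)) := by
  refine inDomainC2_reflectExt (hasDerivAt_sech_add _) (hasDerivAt_neg_th_mul_sech _)
    (expDecay_sech_add _) (expDecay_neg_th_mul_sech _) ((expDecay_sech_add _).potential_mul 2 _)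
    (one_mul _) ?_
  simp only [zero_add, th_artanh hq]
  ring

/-- The condition $v_\lambda'(0+)=-q\,v_\lambda(0)$ holds for every $\lambda$, so its
$\lambda$-derivative inherits it. This is where the value
$c=q/(1-q^2)=-\partial_\lambda\tanh^{-1}(q/\lambda)|_{\lambda=1}$ matters. -/
theorem inDomainC2_genKer (hq : |q| < 1) :
    InDomainC2 q (reflectExt 1 (genKer (Real.artanh q) (q / (1 - q ^ 2))))
      (reflectExt (-1) (genKer₁ (Real.artanh q) (q / (1 - q ^ 2))))
      (reflectExt 1 fun x => (1 - 6 * (1 - th (x + Real.artanh q) ^ 2)) *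
        genKer (Real.artanh q) (q / (1 - q ^ 2)) x + 2 * sech (x + Real.artanh q)) := by
  refine inDomainC2_reflectExt (hasDerivAt_genKer _ _) (hasDerivAt_genKer₁ _ _)
    (expDecay_genKer _ _) (expDecay_genKer₁ _ _)
    (((expDecay_genKer _ _).potential_mul 6 _).add ((expDecay_sech_add _).const_mul 2))
    (one_mul _) ?_
  have h : (1 - (q : ℂ) ^ 2) ≠ 0 := by
    have : (1 - q ^ 2 : ℝ) ≠ 0 := by nlinarith [abs_lt.1 hq, (sq_lt_one_iff_abs_lt_one q).2 hq]
    exact_mod_cast this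
  simp only [genKer, genKer₁, zero_add, th_artanh hq]
  push_cast
  field_simp
  ring

/-- This is $\frac12\partial_\lambda\|v_\lambda\|^2$ at $\lambda=1$, where
$\|v_\lambda\|^2=2(\lambda-q)$. The explicit antiderivative used on the half-line runs from $0$ at
the origin to $1/2$ at infinity. -/
theorem integral_genKer_mul_sech (hq : |q| < 1) :
    ∫ x, reflectExt 1 (genKer (Real.artanh q) (q / (1 - q ^ 2))) x *
      reflectExt 1 (fun x => sech (x + Real.artanh q)) x = 1 := by
  set y := Real.artanh q with hy
  set c : ℝ := q / (1 - q ^ 2) with hc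
  have e : ∀ x, reflectExt 1 (genKer y c) x * reflectExt 1 (fun x => sech (x + y)) x =
      (fun x => genKer y c x * sech (x + y)) |x| := by
    intro x
    rcases lt_or_ge x 0 with hx | hx
    · simp only [reflectExt_of_neg hx, abs_of_neg hx]; ring
    · simp only [reflectExt_of_nonneg hx, abs_of_nonneg hx]
  have hint : IntegrableOn (fun x => genKer y c x * sech (x + y)) (Set.Ioi 0) :=
    (expDecay_genKer y c).memLp.integrable_mul (expDecay_sech_add y).memLp
  rw [(integral_congr_ae (Eventually.of_forall e)).trans (integral_comp_abs_complex hint)]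
  have hd : ∀ x ∈ Set.Ici (0 : ℝ),
      HasDerivAt (fun x : ℝ => (th (x + y) + ((x : ℂ) - c) * sech (x + y) ^ 2) / 2)
        (genKer y c x * sech (x + y)) x := fun x _ => by
    refine (((hasDerivAt_th_add y x).add ((hasDerivAt_ofReal_sub c x).mul
      ((hasDerivAt_sech_add y x).pow 2))).div_const 2).congr_deriv ?_
    simp only [Pi.pow_apply, genKer]
    rw [← sech_sq]
    push_cast
    ring
  have ht : Tendsto (fun x : ℝ => (th (x + y) + ((x : ℂ) - c) * sech (x + y) ^ 2) / 2) atTop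
      (𝓝 (1 / 2)) := by
    have h1 : Tendsto (fun x => sech (x + y)) atTop (𝓝 0) := (expDecay_sech_add y).tendsto
    have h2 : Tendsto (fun x : ℝ => ((x + y : ℝ) : ℂ) * sech (x + y)) atTop (𝓝 0) :=
      (expDecay_id_mul_sech.comp_add y).tendsto
    have h3 : Tendsto (fun x => th (x + y)) atTop (𝓝 1) := by
      have h4 := ((expDecay_exp (k := 1) (by norm_num)).comp_add y).tendsto
      have h5 : Tendsto (fun x => 1 - Complex.exp (-(1 * ((x + y : ℝ) : ℂ))) * sech (x + y)) atTop
          (𝓝 1) := by simpa using (h4.mul h1).const_sub 1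
      refine h5.congr fun x => ?_
      have h6 : Real.tanh (x + y) = 1 - Real.exp (-(x + y)) * (Real.cosh (x + y))⁻¹ := by
        have := (Real.cosh_pos (x + y)).ne'
        rw [Real.tanh_eq_sinh_div_cosh]
        field_simp
        linarith [Real.cosh_sub_sinh (x + y)]
      rw [th, h6, sech]
      push_cast
      ring_nf
    have h7 : Tendsto (fun x : ℝ => (th (x + y) + (((x + y : ℝ) : ℂ) * sech (x + y) * sech (x + y) -
        (y + c) * (sech (x + y) * sech (x + y)))) / 2) atTop (𝓝 (1 / 2)) := by
      simpa using (h3.add ((h2.mul h1).sub ((h1.mul h1).const_mul ((y : ℂ) + c)))).div_const 2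
    refine h7.congr fun x => ?_
    push_cast
    ring
  rw [integral_Ioi_of_hasDerivAt_of_tendsto' hd hint ht]
  have h : (1 - (q : ℂ) ^ 2) ≠ 0 := by
    have : (1 - q ^ 2 : ℝ) ≠ 0 := by nlinarith [abs_lt.1 hq, (sq_lt_one_iff_abs_lt_one q).2 hq]
    exact_mod_cast this
  rw [zero_add, sech_sq, hy, th_artanh hq, hc]
  push_cast
  field_simp
  ring

/-- The kernel and the generalized kernel of `F q`. -/
theorem genEigenspace_zero (hq : |q| < 1 / 100) (h0 : q ≠ 0) {V D : L2}
    (hV : V =ᵐ[volume] reflectExt 1 fun x => sech (x + Real.artanh q))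
    (hD : D =ᵐ[volume] reflectExt 1 (genKer (Real.artanh q) (q / (1 - q ^ 2)))) :
    genEigenspace (F q) 0 = Submodule.span ℂ {(0, V), (D, 0)} ∧
    LinearIndependent ℂ ![((0, V) : L2 × L2), (D, 0)] ∧
    (∃ h : ((0, V) : L2 × L2) ∈ (F q).domain, F q ⟨(0, V), h⟩ = 0) ∧
    (∃ h : ((D, 0) : L2 × L2) ∈ (F q).domain, F q ⟨(D, 0), h⟩ = (0, V)) := by
  have hq1 : |q| < 1 := hq.trans (by norm_num)
  have iV := inDomainC2_sech hq1
  have iD := inDomainC2_genKer hq1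
  have hint := integral_genKer_mul_sech hq1
  set y := Real.artanh q with hy
  set v := reflectExt 1 fun x => sech (x + y) with hv
  set d := reflectExt 1 (genKer y (q / (1 - q ^ 2))) with hd
  have hz : ((0 : L2) : ℝ → ℂ) =ᵐ[volume] fun _ => 0 := Lp.coeFn_zero _ _ _
  have ev : ∀ x, reflectExt 1 (fun x => (1 - 2 * (1 - th (x + y) ^ 2)) * sech (x + y)) x =
      (1 - 2 * (1 - th (|x| + y) ^ 2)) * v x := fun x => by
    rcases lt_or_ge x 0 with hx | hx
    · simp only [hv, reflectExt_of_neg hx, abs_of_neg hx]; ring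
    · simp only [hv, reflectExt_of_nonneg hx, abs_of_nonneg hx]
  have ed : ∀ x, reflectExt 1 (fun x => (1 - 6 * (1 - th (x + y) ^ 2)) *
      genKer y (q / (1 - q ^ 2)) x + 2 * sech (x + y)) x =
      (1 - 6 * (1 - th (|x| + y) ^ 2)) * d x + 2 * v x := fun x => by
    rcases lt_or_ge x 0 with hx | hx
    · simp only [hv, hd, reflectExt_of_neg hx, abs_of_neg hx]; ring
    · simp only [hv, hd, reflectExt_of_nonneg hx, abs_of_nonneg hx]
  have FV : ∃ h : ((0, V) : L2 × L2) ∈ (F q).domain, F q ⟨(0, V), h⟩ = 0 :=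
    F_eq_of_inDomain hz hV hz hz (InDomain.zero q) iV.toInDomain (fun x _ => by simp)
      (fun x _ => by rw [ev]; ring)
  have FD : ∃ h : ((D, 0) : L2 × L2) ∈ (F q).domain, F q ⟨(D, 0), h⟩ = (0, V) :=
    F_eq_of_inDomain hD hz hz hV iD.toInDomain (InDomain.zero q) (fun x _ => ed x)
      (fun x _ => by simp)
  -- the kernel
  have hker : ∀ u : L2 × L2, (∃ h : u ∈ (F q).domain, F q ⟨u, h⟩ = 0) →
      ∃ t : ℂ, u = t • ((0, V) : L2 × L2) := by
    rintro u ⟨hu, hFu⟩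
    obtain ⟨f, f₁, g, g₁, huf, hug, H⟩ := exists_fRep_eigen (q := q) (z := Complex.I * 0) (u := u)
      ⟨hu, by rw [hFu, mul_zero, zero_smul, sub_zero]⟩
    have one : ‖(1 : ℂ) - 1‖ ≤ 1 / 8 := by norm_num
    obtain ⟨e, d, o, p, h1, -, h3, h4, h5⟩ :=
      H.exists_coeff (k := 1) (m := 1) (by norm_num) (by norm_num) one one
        (hq.trans (by norm_num))
    -- Here $q\ne0$ enters: the odd determinant at $l=0$ vanishes only if `eigSq q` does. At $q=0$
    -- the translation mode would be an odd kernel element.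
    have hdet := mt (jost_det_eq_zero_iff (l := 0) (k := 1) (m := 1) hq (by norm_num)
      (by norm_num) one one).1 (by
        rw [zero_pow two_ne_zero, eq_comm, Complex.ofReal_eq_zero]
        exact eigSq_ne_zero hq h0)
    have ho : o = 0 := by
      refine mul_right_cancel₀ hdet ?_
      linear_combination jostB 1 (Real.artanh q) * h3 + jostA 1 (Real.artanh q) * h4
    have hp : p = 0 := by
      refine mul_right_cancel₀ hdet ?_
      linear_combination jostB 1 (Real.artanh q) * h3 - jostA 1 (Real.artanh q) * h4
    -- At $l=0$ both exponents are $1$ and the system decouples. The second component, a multiple of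
    -- $\mathrm{sech}$, meets the boundary condition automatically; the first does not, so its
    -- coefficient $e+d$ vanishes.
    have hed : e + d = 0 := by
      have hc : jostA₁ 1 (Real.artanh q) + q * jostA 1 (Real.artanh q) ≠ 0 := by
        have := jostA₁_add_mul 1 (Real.artanh q)
        rw [th_artanh hq1] at this
        rw [this]
        have h6 : (1 + q) * (3 - 2 * q ^ 2 - 1 ^ 2) ≠ 0 := by
          have := abs_lt.1 hq
          have h7 := (sq_lt_one_iff_abs_lt_one q).2 hq1
          exact mul_ne_zero (by linarith) (by linarith)
        exact mul_ne_zero (by exact_mod_cast h6) (Complex.exp_ne_zero _)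
      refine mul_right_cancel₀ hc ?_
      linear_combination h1
    subst ho hp
    have hd' : d = -e := by linear_combination hed
    subst hd'
    have hB : ∀ x, jostB 1 x = 2 * sech x := fun x => by
      rw [jostB, sech_eq_exp]; ring_nf
    refine ⟨Complex.I * (4 * e), Prod.ext ?_ ?_⟩
    · refine (Lp_eq_smul (t := 0) huf hz fun x hx => ?_).trans (by simp)
      refine (eq_mul_reflectExt (t := 0) (ε := 1) (A := 0) (fun x hx => ?_) x hx).trans (by simp)
      obtain ⟨r1, r2, -, -⟩ := h5 x hx
      rw [r1, r2]
      constructor <;> ring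
    · refine Lp_eq_smul hug hV (eq_mul_reflectExt fun x hx => ?_)
      obtain ⟨-, -, r1, r2⟩ := h5 x hx
      rw [r1, r2, hB]
      constructor <;> ring
  -- solvability
  have hsolv : ∀ (u : L2 × L2) (α γ : ℂ), (∃ h : u ∈ (F q).domain,
      F q ⟨u, h⟩ = α • ((0, V) : L2 × L2) + γ • ((D, 0) : L2 × L2)) → γ = 0 := by
    rintro u α γ ⟨hu, hFu⟩
    have cv := iV.continuous
    have cd := iD.continuous
    obtain ⟨f, f₁, g, g₁, huf, hug, H⟩ := exists_fRep (q := q) (z := 0) (u := u)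
      (r := α • ((0, V) : L2 × L2) + γ • ((D, 0) : L2 × L2)) (ρ₁ := fun x => γ * d x)
      (ρ₂ := fun x => α * v x) ⟨hu, by rw [hFu, zero_smul, sub_zero]⟩
      (by
        filter_upwards [hD, Lp.coeFn_smul γ D] with x e1 e2
        simp [e1, e2])
      (by
        filter_upwards [hV, Lp.coeFn_smul α V] with x e1 e2
        simp [e1, e2])
      (fun x _ => (cd.const_mul γ).continuousAt) (fun x _ => (cv.const_mul α).continuousAt)
    have key := H.snd.integral_eq_zero iV
    have e : ∀ x, ((1 - 2 * (1 - th (|x| + Real.artanh q) ^ 2)) * g x -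
        2 * (0 * f x + γ * d x)) * v x -
        g x * reflectExt 1 (fun x => (1 - 2 * (1 - th (x + y) ^ 2)) * sech (x + y)) x =
        (-2 * γ) * (d x * v x) := fun x => by
      rw [ev]; ring
    rw [integral_congr_ae (Eventually.of_forall e), integral_const_mul, hint] at key
    linear_combination -key / 2
  have hVD : ∀ s t : ℂ, s • ((0, V) : L2 × L2) + t • ((D, 0) : L2 × L2) = 0 → s = 0 ∧ t = 0 := by
    intro s t h
    have h1 : t • D = 0 := by simpa using congrArg Prod.fst h
    have h2 : s • V = 0 := by simpa using congrArg Prod.snd h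
    have hne : D ≠ 0 ∧ V ≠ 0 := by
      constructor
      · rintro rfl
        have : ∫ x, d x * v x = 0 := integral_eq_zero_of_ae (by
          filter_upwards [hD, hz] with x e1 e2
          rw [← e1, e2, zero_mul]; rfl)
        rw [this] at hint
        exact zero_ne_one hint
      · rintro rfl
        have : ∫ x, d x * v x = 0 := integral_eq_zero_of_ae (by
          filter_upwards [hV, hz] with x e1 e2
          rw [← e1, e2, mul_zero]; rfl)
        rw [this] at hint
        exact zero_ne_one hint
    exact ⟨(smul_eq_zero.1 h2).resolve_right hne.2, (smul_eq_zero.1 h1).resolve_right hne.1⟩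
  refine ⟨le_antisymm (genEigenspace_le fun u hu hmem => ?_) ?_,
    LinearIndependent.pair_iff.2 hVD, FV, FD⟩
  · obtain ⟨α, γ, h⟩ := Submodule.mem_span_pair.1 hmem
    rw [zero_smul, sub_zero] at h
    have hγ := hsolv u α γ ⟨hu, h.symm⟩
    subst hγ
    rw [zero_smul, add_zero] at h
    obtain ⟨hDd, hFD⟩ := FD
    -- Solvability has reduced the equation to $F_qu=\alpha(0,V)=\alpha F_q(D,0)$, so the difference
    -- lies in the kernel.
    obtain ⟨t, ht⟩ := hker (u - α • ((D, 0) : L2 × L2))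
      ⟨sub_mem hu (Submodule.smul_mem _ _ hDd), by
        have := (F q).map_sub ⟨u, hu⟩ (α • ⟨(D, 0), hDd⟩)
        rw [LinearPMap.map_smul, hFD, h, sub_self] at this
        exact this⟩
    exact Submodule.mem_span_pair.2 ⟨t, α, by rw [← ht]; abel⟩
  · have hV1 : ((0, V) : L2 × L2) ∈ kerPow (F q) 0 1 := by
      obtain ⟨h, e⟩ := FV
      exact mem_kerPow_one ⟨h, by rw [e, zero_smul]⟩
    refine Submodule.span_le.2 ?_
    rintro w (rfl | rfl)
    · exact mem_genEigenspace_of_mem_kerPow hV1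
    · obtain ⟨h, e⟩ := FD
      refine mem_genEigenspace_of_mem_kerPow (n := 2) ((mem_kerPow_succ _ _ 1 _).2 ⟨h, ?_⟩)
      rw [e, zero_smul, sub_zero]
      exact hV1

end

/-! ### Choice of the root and assembly of the theorem. -/

theorem span_singleton_eq_of_mem {E : Type*} [AddCommGroup E] [Module ℂ E] {w w' : E}
    (h : w' ∈ Submodule.span ℂ {w}) (h0 : w' ≠ 0) :
    Submodule.span ℂ {w} = Submodule.span ℂ {w'} := by
  obtain ⟨t, rfl⟩ := Submodule.mem_span_singleton.1 h
  have ht : t ≠ 0 := fun ht => h0 (by rw [ht, zero_smul])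
  exact (Submodule.span_singleton_smul_eq (IsUnit.mk0 t ht) w).symm

/-- The eigenvalue of `-i F q` near `√q`. -/
def eigRoot (q : ℝ) : ℂ :=
  if 0 < q then (√(|eigSq q|) : ℂ) else Complex.I * (√(|eigSq q|) : ℂ)

theorem norm_eigRoot (q : ℝ) : ‖eigRoot q‖ = √(|eigSq q|) := by
  rw [eigRoot]
  split_ifs <;> simp [abs_of_nonneg (Real.sqrt_nonneg _)]

theorem eigRoot_sq {q : ℝ} (hq : |q| < 1 / 100) (h0 : q ≠ 0) : eigRoot q ^ 2 = eigSq q := by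
  have h := Real.sq_sqrt (abs_nonneg (eigSq q))
  rw [eigRoot]
  split_ifs with hp
  · rw [abs_of_pos (eigSq_pos hq hp)] at *
    exact_mod_cast h
  · have hn := eigSq_neg hq (lt_of_le_of_ne (not_lt.1 hp) h0)
    rw [abs_of_neg hn] at *
    rw [mul_pow, Complex.I_sq, ← Complex.ofReal_pow, h]
    simp

theorem norm_eigRoot_lt {q : ℝ} (hq : |q| < 1 / 1000) : ‖eigRoot q‖ < 1 / 16 := by
  rw [norm_eigRoot, Real.sqrt_lt' (by norm_num)]
  have h1 := abs_eigSq_sub_le (hq.trans (by norm_num))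
  have h2 := abs_sub_abs_le_abs_sub (eigSq q) q
  have h3 := sq_abs q
  nlinarith [abs_nonneg q]

theorem norm_eigRoot_sub_le {q : ℝ} (hq : |q| < 1 / 100) :
    (0 < q → ‖eigRoot q - (√q : ℂ)‖ ≤ 2 * |q| ^ (3 / 2 : ℝ)) ∧
      (q < 0 → ‖eigRoot q - Complex.I * (√(|q|) : ℂ)‖ ≤ 2 * |q| ^ (3 / 2 : ℝ)) := by
  have h := abs_sqrt_abs_eigSq_sub_le hq
  constructor
  · intro hp
    rw [eigRoot, if_pos hp, ← Complex.ofReal_sub, Complex.norm_real, Real.norm_eq_abs]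
    rwa [abs_of_pos hp] at h ⊢
  · intro hn
    rw [eigRoot, if_neg hn.not_gt, ← mul_sub, ← Complex.ofReal_sub, norm_mul, Complex.norm_I,
      one_mul, Complex.norm_real, Real.norm_eq_abs]
    exact h

theorem isEigenvalue_cases {q : ℝ} {z : ℂ} (hq : |q| < 1 / 100) (hz : ‖z‖ < 1 / 16)
    (h : IsEigenvalue (F q) z) : z = 0 ∨ (-Complex.I * z) ^ 2 = eigSq q := by
  by_contra! hne
  obtain ⟨u, hu0, hu⟩ := h
  have e : Complex.I * (-Complex.I * z) = z := by
    linear_combination -z * Complex.I_sq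
  refine hu0 (eq_zero_of_eigen hq (l := -Complex.I * z)
    (mul_ne_zero (neg_ne_zero.2 Complex.I_ne_zero) hne.1) ?_ hne.2 ⟨u.2, ?_⟩)
  · rw [norm_mul, norm_neg, Complex.norm_I, one_mul]; exact hz.le
  · rw [e]
    exact sub_eq_zero.2 hu

end DeltaNLS

end

theorem mainTheorem8 :
    ∃ q₀ > (0 : ℝ), ∃ δ > (0 : ℝ), ∃ C > (0 : ℝ), ∀ q : ℝ, 0 < |q| → |q| < q₀ →
      (∀ x : ℝ, DifferentiableAt ℝ (fun l => DeltaNLS.groundState q l x) 1) ∧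
      ∃ V D : DeltaNLS.L2,
        V =ᵐ[volume] (fun x : ℝ => (DeltaNLS.groundState q 1 x : ℂ)) ∧
        D =ᵐ[volume] (fun x : ℝ => ((deriv (fun l => DeltaNLS.groundState q l x) 1 : ℝ) : ℂ)) ∧
        -- the generalized kernel
        DeltaNLS.genEigenspace (DeltaNLS.F q) 0 = Submodule.span ℂ {(0, V), (D, 0)} ∧
        LinearIndependent ℂ ![((0, V) : DeltaNLS.L2 × DeltaNLS.L2), (D, 0)] ∧
        (∃ h : ((0, V) : DeltaNLS.L2 × DeltaNLS.L2) ∈ (DeltaNLS.F q).domain, DeltaNLS.F q ⟨(0, V), h⟩ = 0) ∧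
        (∃ h : ((D, 0) : DeltaNLS.L2 × DeltaNLS.L2) ∈ (DeltaNLS.F q).domain, DeltaNLS.F q ⟨(D, 0), h⟩ = (0, V)) ∧
        -- the two further eigenvalues near zero
        ∃ lp lm : ℂ, lp ≠ 0 ∧ lm ≠ 0 ∧ lp ≠ lm ∧
          {z : ℂ | DeltaNLS.IsEigenvalue (DeltaNLS.F q) z ∧ ‖z‖ < δ} =
            {0, Complex.I * lp, Complex.I * lm} ∧
          (0 < q → ‖lp - (Real.sqrt q : ℂ)‖ ≤ C * |q| ^ (3 / 2 : ℝ) ∧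
            ‖lm - -(Real.sqrt q : ℂ)‖ ≤ C * |q| ^ (3 / 2 : ℝ)) ∧
          (q < 0 → ‖lp - Complex.I * (Real.sqrt |q| : ℂ)‖ ≤ C * |q| ^ (3 / 2 : ℝ) ∧
            ‖lm - -(Complex.I * (Real.sqrt |q| : ℂ))‖ ≤ C * |q| ^ (3 / 2 : ℝ)) ∧
          -- their eigenfunctions
          ∃ wp wm : DeltaNLS.L2 × DeltaNLS.L2, wp ≠ 0 ∧ wm ≠ 0 ∧
            (∃ h : wp ∈ (DeltaNLS.F q).domain,
              DeltaNLS.F q ⟨wp, h⟩ = (Complex.I * lp) • wp) ∧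
            (∃ h : wm ∈ (DeltaNLS.F q).domain,
              DeltaNLS.F q ⟨wm, h⟩ = (Complex.I * lm) • wm) ∧
            DeltaNLS.genEigenspace (DeltaNLS.F q) (Complex.I * lp) = Submodule.span ℂ {wp} ∧
            DeltaNLS.genEigenspace (DeltaNLS.F q) (Complex.I * lm) = Submodule.span ℂ {wm} ∧
            DeltaNLS.IsOdd wp ∧ DeltaNLS.IsOdd wm ∧
            DeltaNLS.sigma3 wp = wm ∧ DeltaNLS.sigma3 wm = wp := by
  -- $\delta=1/16$ keeps both exponents within $1/8$ of $1$. For $|q|<1/1000$ the bound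
  -- $|q|+2q^2<1/256$ puts both eigenvalues inside that disc. $C=2$ comes from $|{\rm
  -- eigSq}-q|\le2q^2$.
  refine ⟨1 / 1000, by norm_num, 1 / 16, by norm_num, 2, by norm_num, fun q hq0 hq => ?_⟩
  have h0 : q ≠ 0 := abs_pos.1 hq0
  have hq' : |q| < 1 / 100 := hq.trans (by norm_num)
  have hq1 : |q| < 1 := hq.trans (by norm_num)
  refine ⟨fun x => (DeltaNLS.hasDerivAt_groundState hq1 x).differentiableAt, ?_⟩
  have hV := (DeltaNLS.inDomainC2_sech hq1).memLp.coeFn_toLp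
  have hD := (DeltaNLS.inDomainC2_genKer hq1).memLp.coeFn_toLp
  obtain ⟨g1, g2, g3, g4⟩ := DeltaNLS.genEigenspace_zero hq' h0 hV hD
  refine ⟨_, _, hV.trans (Eventually.of_forall fun x => ?_),
    hD.trans (Eventually.of_forall fun x => ?_), g1, g2, g3, g4, ?_⟩
  · beta_reduce
    rw [DeltaNLS.groundState_one]
    rcases lt_or_ge x 0 with hx | hx
    · rw [DeltaNLS.reflectExt_of_neg hx, abs_of_neg hx, one_mul]
    · rw [DeltaNLS.reflectExt_of_nonneg hx, abs_of_nonneg hx]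
  · beta_reduce
    rw [(DeltaNLS.hasDerivAt_groundState hq1 x).deriv]
    rcases lt_or_ge x 0 with hx | hx
    · rw [DeltaNLS.reflectExt_of_neg hx, abs_of_neg hx, one_mul]
      simp [DeltaNLS.genKer, DeltaNLS.th, DeltaNLS.sech]
    · rw [DeltaNLS.reflectExt_of_nonneg hx, abs_of_nonneg hx]
      simp [DeltaNLS.genKer, DeltaNLS.th, DeltaNLS.sech]
  set lp := DeltaNLS.eigRoot q with hlp
  have hsq : lp ^ 2 = DeltaNLS.eigSq q := DeltaNLS.eigRoot_sq hq' h0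
  have hlt : ‖lp‖ < 1 / 16 := DeltaNLS.norm_eigRoot_lt hq
  have hl0 : lp ≠ 0 := fun h => DeltaNLS.eigSq_ne_zero hq' h0 (by
    rw [h, zero_pow two_ne_zero] at hsq
    exact_mod_cast hsq.symm)
  obtain ⟨wp, wp0, wpodd, wpeq, wpgen⟩ := DeltaNLS.exists_odd_eigen hq' hl0 hlt.le hsq
  -- Only the one-dimensionality at $-l$ is used; the spanning vector is then replaced by
  -- $\sigma_3w^+$, so that $\sigma_3$ exchanges the two exactly and not just up to a scalar.
  obtain ⟨w', -, -, -, wgen'⟩ := DeltaNLS.exists_odd_eigen (l := -lp) hq' (neg_ne_zero.2 hl0)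
    (by rw [norm_neg]; exact hlt.le) (by rw [neg_sq, hsq])
  have wm0 : DeltaNLS.sigma3 wp ≠ 0 := fun h => wp0 (by
    rw [← DeltaNLS.sigma3_sigma3 wp, h]; simp [DeltaNLS.sigma3])
  have wmeq := DeltaNLS.F_sigma3 wpeq
  rw [← mul_neg] at wmeq
  have wmgen : DeltaNLS.genEigenspace (DeltaNLS.F q) (Complex.I * -lp) =
      Submodule.span ℂ {DeltaNLS.sigma3 wp} := by
    have hmem := DeltaNLS.mem_genEigenspace_of_mem_kerPow (DeltaNLS.mem_kerPow_one wmeq)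
    rw [wgen'] at hmem ⊢
    exact DeltaNLS.span_singleton_eq_of_mem hmem wm0
  obtain ⟨b1, b2⟩ := DeltaNLS.norm_eigRoot_sub_le hq'
  refine ⟨lp, -lp, hl0, neg_ne_zero.2 hl0, fun h => hl0 (self_eq_neg.1 h), ?_,
    fun hp => ⟨b1 hp, ?_⟩, fun hn => ⟨b2 hn, ?_⟩, wp, DeltaNLS.sigma3 wp, wp0, wm0, wpeq, wmeq,
    wpgen, wmgen, wpodd, wpodd.sigma3, rfl, DeltaNLS.sigma3_sigma3 wp⟩
  · ext z
    simp only [Set.mem_ofPred_eq, Set.mem_insert_iff, Set.mem_singleton_iff]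
    constructor
    · rintro ⟨hz, hzn⟩
      rcases DeltaNLS.isEigenvalue_cases hq' hzn hz with h | h
      · exact Or.inl h
      · have e : z = Complex.I * (-Complex.I * z) := by linear_combination z * Complex.I_sq
        rw [← hsq] at h
        rcases sq_eq_sq_iff_eq_or_eq_neg.1 h with h | h
        · exact Or.inr (Or.inl (by rw [e, h]))
        · exact Or.inr (Or.inr (by rw [e, h]))
    · rintro (rfl | rfl | rfl)
      · obtain ⟨h, e⟩ := g3
        refine ⟨⟨⟨_, h⟩, ?_, by rw [e, zero_smul]⟩, by norm_num⟩
        exact (LinearIndependent.ne_zero (0 : Fin 2) g2)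
      · obtain ⟨h, e⟩ := wpeq
        exact ⟨⟨⟨_, h⟩, wp0, e⟩, by rwa [norm_mul, Complex.norm_I, one_mul]⟩
      · obtain ⟨h, e⟩ := wmeq
        exact ⟨⟨⟨_, h⟩, wm0, e⟩, by rwa [norm_mul, Complex.norm_I, one_mul, norm_neg]⟩
  · rw [← neg_sub', norm_neg]
    exact b1 hp
  · rw [← neg_sub', norm_neg]
    exact b2 hn
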